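/- **Setting.** Let $L\ge 0$ and let $D_0=1$ and $D_k,D'_k$ ($1\le k\le L$) be positive integers with $D_{k-1}\le (D'_k)^2$ and $D'_k\le D_k$. Start from the unit vector $\psi(0)=\psi_0$ of a single site with Hilbert space of dimension $D_0=1$, and put, for $1\le k\le L$, $$\phi(k)=V_k\,\psi(k-1),\qquad \psi(k)=W_k\,\phi(k),$$ both of them states of $2^k$ sites numbered modulo $2^k$, of dimension $D'_k$ per site for $\phi(k)$ and $D_k$ per site for $\psi(k)$. Here $V_k$ is a product of $2^{k-1}$ isometries, the $p$-th one mapping site $p$ to the pair of sites $2p,2p+1$, and $W_k$ is a product of $2^{k-1}$ isometries, the $p$-th one mapping the pair of sites $2p+1,\,2p+2 \bmod 2^k$ to the same pair. All these isometries are independent and distributed according to the Haar uniform distribution, and $E$ denotes the average over all of them. Let $\sigma(k)=|\psi(k)\rangle\langle\psi(k)|$ and $\tau(k)=|\phi(k)\rangle\langle\phi(k)|$. For a set $A$ of sites let $\rho_A$ be the reduced density matrix of $\rho$ on $A$, and let $S_2(\rho)=-\log\operatorname{tr}(\rho^2)$. For integers $i\le j+1$ with $j-i+1\le 2^k$ let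 $[i,j]$ be the interval of the $j-i+1$ sites $i,i+1,\dots,j$ modulo $2^k$; it is called *empty* if $i\equiv j+1 \pmod{2^k}$ (so the whole ring, on which the state is pure, is treated like the empty interval). **Reduction sequences.** A reduction sequence $Q$ for $\sigma(k)_{[i,j]}$ or $\tau(k)_{[i,j]}$ is a sequence of choices of the following form, continued until the interval is empty, where it stops. From a non-empty interval $[i,j]$ of $\sigma(k)$, choose $m$ odd and $n$ even with $|m-i|\le1$, $|n-j|\le1$ and pass to $[m,n]$ of $\tau(k)$; this step costs $\log(D_k)\,(|m-i|+|n-j|)$. From a non-empty interval $[i,j]$ of $\tau(k)$, choose $m$ even and $n$ odd with $|m-i|\le1$, $|n-j|\le1$ and pass to $[m/2,(n-1)/2]$ of $\sigma(k-1)$; this step costs $\log(D'_k)\,(|m-i|+|n-j|)$. Let $S(Q)$ be the sum of the costs of the steps of $Q$, and let the height $h(Q)$ be their number. **Lemma.** There is a universal constant $C>0$ (independent of $L$, of all the dimensions, and of the interval) such that, for every $L$ and all dimensions as above, $$E\bigl[S_2(\sigma(k)_{[i,j]})\bigr]\;\ge\;\min_Q\bigl(S(Q)-C\,h(Q)\bigr)\qquad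 (0\le k\le L)$$ and $$E\bigl[S_2(\tau(k)_{[i,j]})\bigr]\;\ge\;\min_Q\bigl(S(Q)-C\,h(Q)\bigr)\qquad (1\le k\le L)$$ for every interval $[i,j]$ at level $k$, the minimum being over all reduction sequences $Q$ for $\sigma(k)_{[i,j]}$, respectively $\tau(k)_{[i,j]}$. In particular the expectations are finite and the minima are attained. -/

import Mathlib

open MeasureTheory

namespace RandomMERA

noncomputable section

/-! ### Haar-random isometries -/

/-- Matrices carry the product sigma-algebra of their entries. -/
instance instMeasurableSpaceMatrix (m n : Type) : MeasurableSpace (Matrix m n ℂ) :=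
  inferInstanceAs (MeasurableSpace (m → n → ℂ))

instance instBorelSpaceMatrix (m n : Type) [Fintype m] [Fintype n] :
    BorelSpace (Matrix m n ℂ) :=
  inferInstanceAs (BorelSpace (m → n → ℂ))

/-- The unitary group is compact; this is what makes its Haar measure finite. -/
instance instCompactSpaceUnitary (m : Type) [Fintype m] [DecidableEq m] :
    CompactSpace (Matrix.unitaryGroup m ℂ) := by
  have hcl : IsClosed ((Matrix.unitaryGroup m ℂ : Submonoid (Matrix m m ℂ)) :
      Set (Matrix m m ℂ)) := isClosed_unitary
  have hK : IsCompact (Set.univ.pi fun _ : m => Set.univ.pi fun _ : m =>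
      Metric.closedBall (0 : ℂ) 1) :=
    isCompact_univ_pi fun _ => isCompact_univ_pi fun _ => isCompact_closedBall 0 1
  refine isCompact_iff_compactSpace.mp (IsCompact.of_isClosed_subset hK hcl ?_)
  intro U hU i _ j _
  simpa using entry_norm_bound_of_unitary (𝕜 := ℂ) hU i j

/-- The normalized Haar measure on the unitary group. -/
def haarUnitary (m : Type) [Fintype m] [DecidableEq m] : Measure (Matrix.unitaryGroup m ℂ) :=
  Measure.haarMeasure ⊤

/-- Isometries from `ℂ^n` to `ℂ^m`: the `m × n` matrices `M` with `M† M = 1`. -/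
abbrev Isom (m n : Type) [Fintype m] [DecidableEq n] : Type :=
  {M : Matrix m n ℂ // M.conjTranspose * M = 1}

/-- The isometry `U M`, for `U` unitary and `M` an isometry. -/
def Isom.rotate {m n : Type} [Fintype m] [DecidableEq m] [DecidableEq n]
    (U : Matrix.unitaryGroup m ℂ) (M : Isom m n) : Isom m n :=
  ⟨U.1 * M.1, by
    have hU : (U.1).conjTranspose * U.1 = 1 := Matrix.mem_unitaryGroup_iff'.mp U.2
    rw [Matrix.conjTranspose_mul, Matrix.mul_assoc, ← Matrix.mul_assoc _ U.1, hU,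
      Matrix.one_mul, M.2]⟩

/-- The random rotation is measurable, so the law below is a genuine image measure. -/
theorem Isom.measurable_rotate {m n : Type} [Fintype m] [DecidableEq m] [Fintype n]
    [DecidableEq n] (M : Isom m n) :
    Measurable fun U : Matrix.unitaryGroup m ℂ => Isom.rotate U M := by
  have : Continuous fun U : Matrix.unitaryGroup m ℂ => Isom.rotate U M := by
    unfold Isom.rotate
    refine Continuous.subtype_mk ?_ _
    fun_prop
  exact this.measurable

open Classical in
/-- The Haar uniform distribution on the isometries from `ℂ^n` to `ℂ^m`: the law of `U M₀` for a
Haar-random unitary `U` and a fixed isometry `M₀` (the law does not depend on `M₀`). It is used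
only where isometries exist, i.e. for `|n| ≤ |m|`. -/
def haarIsometry (m n : Type) [Fintype m] [DecidableEq m] [DecidableEq n] : Measure (Isom m n) :=
  if h : Nonempty (Isom m n) then
    (haarUnitary m).map fun U => Isom.rotate U h.some
  else 0

/-! ### States, reduced density matrices, second Renyi entropy -/

/-- A (pure) state vector of a system of sites `S` with a `d`-dimensional Hilbert space on each
site, given by its amplitudes in the product basis. -/
abbrev State (S : Type) (d : ℕ) : Type := (S → Fin d) → ℂ

/-- The reduced density matrix of `|ψ⟩⟨ψ|` on the set of sites `A`: the partial trace over all
sites outside `A`. -/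
def reducedDensity {S : Type} [Fintype S] [DecidableEq S] {d : ℕ} (ψ : State S d) (A : Finset S) :
    Matrix ({s // s ∈ A} → Fin d) ({s // s ∈ A} → Fin d) ℂ := fun a a' =>
  ∑ b : {s // ¬ s ∈ A} → Fin d,
    ψ ((Equiv.piEquivPiSubtypeProd (fun s => s ∈ A) fun _ => Fin d).symm (a, b)) *
      star (ψ ((Equiv.piEquivPiSubtypeProd (fun s => s ∈ A) fun _ => Fin d).symm (a', b)))

/-- The second Renyi entropy `S₂(ρ) = -log tr ρ²` of a density matrix. -/
def renyiTwo {n : Type} [Fintype n] (ρ : Matrix n n ℂ) : ℝ :=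
  -Real.log (ρ * ρ).trace.re

/-! ### The MERA network

At level `k` there are `2 ^ k` sites on a ring. For `k ≥ 1`, the sites carry dimension `D' k` after
`V_k` and dimension `D k` after `W_k`. -/

/-- The sites at level `k`. -/
abbrev Site (k : ℕ) : Type := ZMod (2 ^ k)

/-- `V_{k+1}`: the isometry `v p` maps site `p` to the pair of sites `2p, 2p+1`. -/
def applyV {k a b : ℕ} (v : Site k → Isom (Fin b × Fin b) (Fin a)) (ψ : State (Site k) a) :
    State (Site (k + 1)) b := fun x =>
  ∑ y : Site k → Fin a,
    (∏ p : Site k,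
      (v p).1 (x ((2 * p.val : ℕ) : Site (k + 1)), x ((2 * p.val + 1 : ℕ) : Site (k + 1))) (y p)) *
      ψ y

/-- `W_{k+1}`: the isometry `w p` maps the pair of sites `2p+1, 2p+2 mod 2^(k+1)` to itself. -/
def applyW {k b c : ℕ} (w : Site k → Isom (Fin c × Fin c) (Fin b × Fin b))
    (φ : State (Site (k + 1)) b) : State (Site (k + 1)) c := fun x =>
  ∑ y : Site (k + 1) → Fin b,
    (∏ p : Site k,
      (w p).1
        (x ((2 * p.val + 1 : ℕ) : Site (k + 1)), x ((2 * p.val + 2 : ℕ) : Site (k + 1)))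
        (y ((2 * p.val + 1 : ℕ) : Site (k + 1)), y ((2 * p.val + 2 : ℕ) : Site (k + 1)))) *
      φ y

/-- All isometries of an `L`-level MERA. The entry at `k : Fin L` holds those of `V_{k+1}` (first
component) and those of `W_{k+1}` (second component). -/
abbrev Gates (L : ℕ) (D D' : ℕ → ℕ) : Type :=
  (k : Fin L) →
    (Site k → Isom (Fin (D' (k + 1)) × Fin (D' (k + 1))) (Fin (D k))) ×
    (Site k → Isom (Fin (D (k + 1)) × Fin (D (k + 1))) (Fin (D' (k + 1)) × Fin (D' (k + 1))))

/-- The law of the random MERA: all isometries are independent and Haar distributed. -/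
def meraLaw (L : ℕ) (D D' : ℕ → ℕ) : Measure (Gates L D D') :=
  Measure.pi fun k : Fin L =>
    (Measure.pi fun _ : Site k =>
      haarIsometry (Fin (D' (k + 1)) × Fin (D' (k + 1))) (Fin (D k))).prod
    (Measure.pi fun _ : Site k =>
      haarIsometry (Fin (D (k + 1)) × Fin (D (k + 1)))
        (Fin (D' (k + 1)) × Fin (D' (k + 1))))

/-- `ψ(k) = W_k V_k ... W_1 V_1 ψ₀`. The initial site has dimension `D 0 = 1`, and `ψ₀` is its
basis vector. -/
def psi {L : ℕ} {D D' : ℕ → ℕ} (g : Gates L D D') : (k : ℕ) → k ≤ L → State (Site k) (D k)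
  | 0, _ => fun _ => 1
  | k + 1, h => applyW (g ⟨k, h⟩).2 (applyV (g ⟨k, h⟩).1 (psi g k (Nat.le_of_succ_le h)))

/-- `phi g k h` is `φ(k+1) = V_{k+1} W_k V_k ... W_1 V_1 ψ₀`. -/
def phi {L : ℕ} {D D' : ℕ → ℕ} (g : Gates L D D') (k : ℕ) (h : k < L) :
    State (Site (k + 1)) (D' (k + 1)) :=
  applyV (g ⟨k, h⟩).1 (psi g k h.le)

/-- The interval of sites `i, i+1, ..., j`, taken modulo `2 ^ k`. -/
def interval (k : ℕ) (i j : ℤ) : Finset (Site k) :=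
  (Finset.Icc i j).image fun z : ℤ => (z : Site k)

/-- `S₂(σ(k)_{[i,j]})`, where `σ(k) = |ψ(k)⟩⟨ψ(k)|`. -/
def entropySigma {L : ℕ} {D D' : ℕ → ℕ} (k : ℕ) (h : k ≤ L) (i j : ℤ) (g : Gates L D D') : ℝ :=
  renyiTwo (reducedDensity (psi g k h) (interval k i j))

/-- `S₂(τ(k+1)_{[i,j]})`, where `τ(k+1) = |φ(k+1)⟩⟨φ(k+1)|`. -/
def entropyTau {L : ℕ} {D D' : ℕ → ℕ} (k : ℕ) (h : k < L) (i j : ℤ) (g : Gates L D D') : ℝ :=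
  renyiTwo (reducedDensity (phi g k h) (interval (k + 1) i j))

/-! ### Reduction sequences -/

/-- The two kinds of rows of the network: after `W_k` (states `σ(k)`), after `V_k` (states
`τ(k)`). -/
inductive Row : Type
  | sigma
  | tau

/-- The interval `[i, j]` of a ring of `2 ^ k` sites is empty: `i = j + 1 mod 2 ^ k`. (By the same
convention the whole ring, on which the state is pure, counts as the empty interval.) -/
def IsEmptyInterval (k : ℕ) (i j : ℤ) : Prop := i ≡ j + 1 [ZMOD 2 ^ k]

/-- Reduction sequences for the interval `[i, j]` in a given row of level `k`, read from the bottom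
of the network upwards. As long as the interval is not empty, one chooses `m, n` of the prescribed
parities with `|m - i| ≤ 1`, `|n - j| ≤ 1`; from `σ(k)` one passes to `[m, n]` in `τ(k)`, and from
`τ(k+1)` one passes to `[m/2, (n-1)/2]` in `σ(k)`. The sequence stops at the empty interval. -/
inductive RedSeq : Row → ℕ → ℤ → ℤ → Type
  | nil {r : Row} {k : ℕ} {i j : ℤ} (empty : IsEmptyInterval k i j) : RedSeq r k i j
  | stepW {k : ℕ} {i j : ℤ} (m n : ℤ) (nonempty : ¬ IsEmptyInterval k i j)
      (hm : m % 2 = 1) (hn : n % 2 = 0) (hmi : |m - i| ≤ 1) (hnj : |n - j| ≤ 1)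
      (Q : RedSeq .tau k m n) : RedSeq .sigma k i j
  | stepV {k : ℕ} {i j : ℤ} (m n : ℤ) (nonempty : ¬ IsEmptyInterval (k + 1) i j)
      (hm : m % 2 = 0) (hn : n % 2 = 1) (hmi : |m - i| ≤ 1) (hnj : |n - j| ≤ 1)
      (Q : RedSeq .sigma k (m / 2) ((n - 1) / 2)) : RedSeq .tau (k + 1) i j

/-- `S(Q)`: the entropy bound obtained along `Q`, i.e. the sum of the logarithms of the bond
dimensions that are cut. -/
def RedSeq.S (D D' : ℕ → ℕ) : {r : Row} → {k : ℕ} → {i j : ℤ} → RedSeq r k i j → ℝ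
  | _, _, _, _, .nil _ => 0
  | _, k, i, j, .stepW m n _ _ _ _ _ Q =>
      Real.log (D k) * ((|m - i| + |n - j| : ℤ) : ℝ) + RedSeq.S D D' Q
  | _, _, i, j, .stepV (k := k) m n _ _ _ _ _ Q =>
      Real.log (D' (k + 1)) * ((|m - i| + |n - j| : ℤ) : ℝ) + RedSeq.S D D' Q

/-- `h(Q)`: the number of reduction steps until the interval is empty. -/
def RedSeq.height : {r : Row} → {k : ℕ} → {i j : ℤ} → RedSeq r k i j → ℕ
  | _, _, _, _, .nil _ => 0
  | _, _, _, _, .stepW _ _ _ _ _ _ _ Q => RedSeq.height Q + 1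
  | _, _, _, _, .stepV _ _ _ _ _ _ _ Q => RedSeq.height Q + 1

end

end RandomMERA

open MeasureTheory

namespace RandomMERA

noncomputable section

/-! ### Purity as a sum over two replicas -/

/-! Since `-log` is convex, the average of `-log tr ρ²` is at least `-log` of the average purity. So
it suffices to show that the average purity is at most `exp (-μ)` whenever `μ ≤ S(Q) - log 9 * h(Q)`
for every reduction sequence `Q`.

The purity of a region `A` is a two-replica quantity: two copies of the state and two conjugate
copies are contracted straight outside `A`, and with the replicas exchanged inside `A`. A
Haar-random gate enters only through its second moment. This commutes with every `V ⊗ V`, hence is a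
combination of identity and swap (`CommutesWithSquares.exists_eq`), and the relation `M† M = 1`
supplies the traces that fix the needed coefficients. After averaging (`integral_gateWeight`), a
gate with both outputs inside or both outside `A` passes this on to its input with weight 1. A gate
cut by the boundary of `A` sends its input to either side, each with weight `c / (c² + 1) ≤ 1 / c`.
By independence, the average purity of `A` after a layer is a sum over regions `B` before the layer,
with products of these weights as coefficients (`integral_purity_layer`).

If `A` is a non-empty interval, a non-zero coefficient forces `B` to be an interval reached by one
reduction step. Each shifted endpoint belongs to its own cut gate, so the coefficient is at most the
exponential of minus the cost (`exists_reduction`). There are at most nine pairs of shifts, so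
paying `log 9` per step absorbs the number of terms (`sum_layerWeight_mul_le`). Induction over the
rows gives the purity bound (`Admissible.integral_purity_psi_le`); it ends at empty or full
intervals, where normalization makes the purity 1.

Integrability holds because the purity is continuous and positive on a compact space of gates. The
minimum is attained because the reduction sequences take finitely many values. -/

/-- The purity `tr ρ_A²` of a state vector with arbitrary on-site configurations, written as a sum
over the configurations of two replicas. -/
def purity {S α : Type} [Fintype S] [DecidableEq S] [Fintype α]
    (ψ : (S → α) → ℂ) (A : Finset S) : ℂ :=
  ∑ x, ∑ y, ψ x * ψ y * star (ψ (A.piecewise y x)) * star (ψ (A.piecewise x y))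

theorem piecewise_piEquivPiSubtypeProd {S : Type} [DecidableEq S] {d : ℕ}
    (A : Finset S) (a a' : {s // s ∈ A} → Fin d) (b b' : {s // ¬ s ∈ A} → Fin d) :
    A.piecewise ((Equiv.piEquivPiSubtypeProd (fun s => s ∈ A) fun _ => Fin d).symm (a, b))
      ((Equiv.piEquivPiSubtypeProd (fun s => s ∈ A) fun _ => Fin d).symm (a', b')) =
    (Equiv.piEquivPiSubtypeProd (fun s => s ∈ A) fun _ => Fin d).symm (a, b') := by
  funext s
  by_cases h : s ∈ A <;> simp [h]

/-- Splitting each replica into its part in `A` and its part outside, the matrix product exchanges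
the parts in `A` between the two conjugated factors, which is what `Finset.piecewise` does. -/
theorem trace_reducedDensity_sq {S : Type} [Fintype S] [DecidableEq S] {d : ℕ}
    (ψ : State S d) (A : Finset S) :
    (reducedDensity ψ A * reducedDensity ψ A).trace = purity ψ A := by
  set e := (Equiv.piEquivPiSubtypeProd (fun s => s ∈ A) fun _ => Fin d).symm with he
  have h1 : purity ψ A = ∑ p, ∑ q, ψ (e p) * ψ (e q) * star (ψ (e (q.1, p.2))) *
      star (ψ (e (p.1, q.2))) := by
    unfold purity
    rw [← e.sum_comp]
    refine Finset.sum_congr rfl fun p _ => ?_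
    rw [← e.sum_comp]
    refine Finset.sum_congr rfl fun q _ => ?_
    rw [he, piecewise_piEquivPiSubtypeProd A q.1 p.1 q.2 p.2,
      piecewise_piEquivPiSubtypeProd A p.1 q.1 p.2 q.2]
  rw [h1]
  simp only [Matrix.trace, Matrix.diag, Matrix.mul_apply, reducedDensity, Fintype.sum_prod_type,
    Finset.sum_mul_sum, ← he]
  refine Finset.sum_congr rfl fun a _ => ?_
  rw [Finset.sum_comm]
  refine Finset.sum_congr rfl fun b _ => ?_
  refine Finset.sum_congr rfl fun a' _ => ?_
  refine Finset.sum_congr rfl fun b' _ => ?_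
  ring

theorem renyiTwo_reducedDensity {S : Type} [Fintype S] [DecidableEq S] {d : ℕ}
    (ψ : State S d) (A : Finset S) :
    renyiTwo (reducedDensity ψ A) = -Real.log (purity ψ A).re := by
  rw [renyiTwo, trace_reducedDensity_sq]

theorem purity_empty {S α : Type} [Fintype S] [DecidableEq S] [Fintype α]
    (ψ : (S → α) → ℂ) : purity ψ ∅ = (∑ x, ψ x * star (ψ x)) ^ 2 := by
  simp only [purity, Finset.piecewise_empty, sq, Finset.sum_mul_sum]
  exact Finset.sum_congr rfl fun x _ => Finset.sum_congr rfl fun y _ => by ring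

theorem purity_univ {S α : Type} [Fintype S] [DecidableEq S] [Fintype α]
    (ψ : (S → α) → ℂ) : purity ψ Finset.univ = purity ψ ∅ := by
  simp only [purity, Finset.piecewise_empty, Finset.piecewise_univ]
  exact Finset.sum_congr rfl fun x _ => Finset.sum_congr rfl fun y _ => by ring

theorem star_reducedDensity {S : Type} [Fintype S] [DecidableEq S] {d : ℕ}
    (ψ : State S d) (A : Finset S) (a a' : {s // s ∈ A} → Fin d) :
    star (reducedDensity ψ A a a') = reducedDensity ψ A a' a := by
  simp only [reducedDensity, star_sum, star_mul', star_star]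
  exact Finset.sum_congr rfl fun b _ => mul_comm _ _

theorem purity_re_eq_sum_normSq {S : Type} [Fintype S] [DecidableEq S] {d : ℕ}
    (ψ : State S d) (A : Finset S) :
    (purity ψ A).re = ∑ a, ∑ a', Complex.normSq (reducedDensity ψ A a a') := by
  rw [← trace_reducedDensity_sq]
  simp only [Matrix.trace, Matrix.diag, Matrix.mul_apply, Complex.re_sum]
  refine Finset.sum_congr rfl fun a _ => Finset.sum_congr rfl fun a' _ => ?_
  rw [← star_reducedDensity ψ A a a', Complex.star_def, Complex.mul_conj, Complex.ofReal_re]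

theorem purity_re_nonneg {S : Type} [Fintype S] [DecidableEq S] {d : ℕ}
    (ψ : State S d) (A : Finset S) : 0 ≤ (purity ψ A).re := by
  rw [purity_re_eq_sum_normSq]
  exact Finset.sum_nonneg fun a _ => Finset.sum_nonneg fun a' _ => Complex.normSq_nonneg _

theorem trace_reducedDensity {S : Type} [Fintype S] [DecidableEq S] {d : ℕ}
    (ψ : State S d) (A : Finset S) :
    ∑ a, reducedDensity ψ A a a = ∑ x, ψ x * star (ψ x) := by
  rw [← (Equiv.piEquivPiSubtypeProd (fun s => s ∈ A) fun _ => Fin d).symm.sum_comp,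
    Fintype.sum_prod_type]
  rfl

/-- The purity is the squared Hilbert–Schmidt norm of the reduced density matrix. If it vanished, so
would the diagonal, hence the trace, which is the squared norm of the state. Positivity makes the
logarithm continuous along the gates. -/
theorem purity_re_pos {S : Type} [Fintype S] [DecidableEq S] {d : ℕ}
    (ψ : State S d) (A : Finset S) (h : purity ψ ∅ ≠ 0) : 0 < (purity ψ A).re := by
  refine lt_of_le_of_ne (purity_re_nonneg ψ A) fun h0 => h ?_
  rw [purity_re_eq_sum_normSq] at h0
  have h1 : ∀ a, reducedDensity ψ A a a = 0 := fun a => by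
    have h2 := (Finset.sum_eq_zero_iff_of_nonneg fun a _ =>
      Finset.sum_nonneg fun a' _ => Complex.normSq_nonneg _).mp h0.symm a (Finset.mem_univ a)
    have h3 := (Finset.sum_eq_zero_iff_of_nonneg fun a' _ => Complex.normSq_nonneg _).mp h2 a
      (Finset.mem_univ a)
    exact Complex.normSq_eq_zero.mp h3
  rw [purity_empty, ← trace_reducedDensity ψ A]
  simp [h1]

/-- The purity as a fourfold sum, with one Kronecker delta per site for each conjugated replica. -/
theorem purity_eq_sum_prod {S α : Type} [Fintype S] [DecidableEq S] [Fintype α] [DecidableEq α]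
    (ψ : (S → α) → ℂ) (A : Finset S) :
    purity ψ A = ∑ x, ∑ y, ∑ z, ∑ t, ψ x * ψ y * star (ψ z) * star (ψ t) *
      ∏ s, if s ∈ A then (if z s = y s ∧ t s = x s then (1 : ℂ) else 0)
        else (if z s = x s ∧ t s = y s then 1 else 0) := by
  unfold purity
  refine Finset.sum_congr rfl fun x _ => Finset.sum_congr rfl fun y _ => ?_
  have h : ∀ z t : S → α, (∏ s, if s ∈ A then (if z s = y s ∧ t s = x s then (1 : ℂ) else 0)
        else (if z s = x s ∧ t s = y s then 1 else 0)) =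
      if z = A.piecewise y x then (if t = A.piecewise x y then 1 else 0) else 0 := by
    intro z t
    have : ∀ s, (if s ∈ A then (if z s = y s ∧ t s = x s then (1 : ℂ) else 0)
        else (if z s = x s ∧ t s = y s then 1 else 0)) =
        if z s = A.piecewise y x s ∧ t s = A.piecewise x y s then 1 else 0 := by
      intro s
      by_cases hs : s ∈ A <;> simp [hs]
    simp only [this, Finset.prod_ite_zero, Finset.prod_const_one, Finset.mem_univ, forall_const,
      forall_and, ← ite_and, funext_iff]
  simp only [h, mul_ite, mul_zero, mul_one]
  simp

/-! ### A layer of gates -/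

/-- Configurations on a set of sites that is partitioned into pairs `l p, r p`, as configurations
of pairs. -/
def pairEquiv {P S β : Type} {l r : P → S} (h : Function.Bijective (Sum.elim l r)) :
    (S → β) ≃ (P → β × β) where
  toFun x p := (x (l p), x (r p))
  invFun y s := Sum.elim (fun p => (y p).1) (fun p => (y p).2) ((Equiv.ofBijective _ h).symm s)
  left_inv x := by
    funext s
    obtain ⟨q, rfl⟩ := h.2 s
    have : (Equiv.ofBijective _ h).symm (Sum.elim l r q) = q :=
      (Equiv.ofBijective _ h).symm_apply_apply q
    simp only [this]
    cases q <;> rfl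
  right_inv y := by
    funext p
    have h1 : (Equiv.ofBijective _ h).symm (l p) = Sum.inl p :=
      (Equiv.ofBijective _ h).symm_apply_apply (Sum.inl p)
    have h2 : (Equiv.ofBijective _ h).symm (r p) = Sum.inr p :=
      (Equiv.ofBijective _ h).symm_apply_apply (Sum.inr p)
    simp [h1, h2]

/-- A layer of gates `M p`, each mapping a site `p` of the input to the pair `l p, r p`. -/
def layer {P S α β : Type} [Fintype P] [Fintype S] [DecidableEq P] [Fintype α] (l r : P → S)
    (M : P → Matrix (β × β) α ℂ) (Φ : (P → α) → ℂ) : (S → β) → ℂ := fun x =>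
  ∑ y, (∏ p, M p (x (l p), x (r p)) (y p)) * Φ y

/-- The two-replica transfer weight of a gate, where `a` and `b` tell whether the first and the
second output site belong to the region whose purity is considered. -/
def gateWeight {α β : Type} [Fintype β] (a b : Prop) [Decidable a] [Decidable b]
    (M : Matrix (β × β) α ℂ) (y₁ y₂ y₃ y₄ : α) : ℂ :=
  ∑ x : β × β, ∑ x' : β × β, M x y₁ * M x' y₂ *
    star (M (if a then x'.1 else x.1, if b then x'.2 else x.2) y₃) *
    star (M (if a then x.1 else x'.1, if b then x.2 else x'.2) y₄)

/-- Whether the replicas are exchanged is decided site by site, and every output site belongs to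
exactly one pair. For fixed inputs the sum over output configurations therefore factors over the
gates. -/
theorem purity_layer {P S α β : Type} [Fintype P] [Fintype S] [DecidableEq P] [DecidableEq S]
    [Fintype α] [Fintype β] {l r : P → S}
    (h : Function.Bijective (Sum.elim l r)) (M : P → Matrix (β × β) α ℂ) (Φ : (P → α) → ℂ)
    (A : Finset S) :
    purity (layer l r M Φ) A = ∑ y₁, ∑ y₂, ∑ y₃, ∑ y₄,
      Φ y₁ * Φ y₂ * star (Φ y₃) * star (Φ y₄) *
        ∏ p, gateWeight (l p ∈ A) (r p ∈ A) (M p) (y₁ p) (y₂ p) (y₃ p) (y₄ p) := by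
  classical
  have key : ∀ y₁ y₂ y₃ y₄ : P → α,
      ∏ p, gateWeight (l p ∈ A) (r p ∈ A) (M p) (y₁ p) (y₂ p) (y₃ p) (y₄ p) =
      ∑ x : S → β, ∑ x' : S → β, (∏ p, M p (x (l p), x (r p)) (y₁ p)) *
        (∏ p, M p (x' (l p), x' (r p)) (y₂ p)) *
        star (∏ p, M p (A.piecewise x' x (l p), A.piecewise x' x (r p)) (y₃ p)) *
        star (∏ p, M p (A.piecewise x x' (l p), A.piecewise x x' (r p)) (y₄ p)) := by
    intro y₁ y₂ y₃ y₄
    simp only [gateWeight]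
    rw [Finset.prod_univ_sum, Fintype.piFinset_univ, ← (pairEquiv (β := β) h).sum_comp]
    refine Finset.sum_congr rfl fun x _ => ?_
    rw [Finset.prod_univ_sum, Fintype.piFinset_univ, ← (pairEquiv (β := β) h).sum_comp]
    refine Finset.sum_congr rfl fun x' _ => ?_
    simp only [pairEquiv, Equiv.coe_fn_mk, Finset.prod_mul_distrib, star_prod, Finset.piecewise]
  have expand : ∀ f g h k : (P → α) → ℂ, (∑ y, f y) * (∑ y, g y) * star (∑ y, h y) *
      star (∑ y, k y) = ∑ y₁, ∑ y₂, ∑ y₃, ∑ y₄, f y₁ * g y₂ * star (h y₃) * star (k y₄) := by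
    intro f g h k
    simp only [← Finset.mul_sum, ← Finset.sum_mul, star_sum]
  have comm : ∀ F : (S → β) → (S → β) → (P → α) → (P → α) → (P → α) → (P → α) → ℂ,
      ∑ x, ∑ x', ∑ y₁, ∑ y₂, ∑ y₃, ∑ y₄, F x x' y₁ y₂ y₃ y₄ =
      ∑ y₁, ∑ y₂, ∑ y₃, ∑ y₄, ∑ x, ∑ x', F x x' y₁ y₂ y₃ y₄ := by
    intro F
    have := Finset.sum_comm (s := (Finset.univ : Finset ((S → β) × (S → β))))
      (t := (Finset.univ : Finset ((P → α) × (P → α) × (P → α) × (P → α))))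
      (f := fun p q => F p.1 p.2 q.1 q.2.1 q.2.2.1 q.2.2.2)
    simpa only [Fintype.sum_prod_type] using this
  simp only [key, purity, layer, expand]
  rw [comm]
  refine Finset.sum_congr rfl fun y₁ _ => Finset.sum_congr rfl fun y₂ _ =>
    Finset.sum_congr rfl fun y₃ _ => Finset.sum_congr rfl fun y₄ _ => ?_
  rw [Finset.mul_sum]
  refine Finset.sum_congr rfl fun x _ => ?_
  rw [Finset.mul_sum]
  refine Finset.sum_congr rfl fun x' _ => ?_
  simp only [star_mul']
  ring

/-! ### Topology and measure on the isometries -/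

instance instT2SpaceMatrix (m n : Type) : T2Space (Matrix m n ℂ) :=
  inferInstanceAs (T2Space (m → n → ℂ))

instance instSecondCountableTopologyMatrix (m n : Type) [Fintype m] [Fintype n] :
    SecondCountableTopology (Matrix m n ℂ) :=
  inferInstanceAs (SecondCountableTopology (m → n → ℂ))

section Isometries

variable {m n : Type} [Fintype m] [DecidableEq n]

theorem Isom.sum_star_mul (M : Isom m n) (y z : n) :
    ∑ c, star (M.1 c y) * M.1 c z = if y = z then 1 else 0 := by
  have := congrFun (congrFun M.2 y) z
  simpa [Matrix.mul_apply, Matrix.one_apply] using this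

theorem Isom.norm_entry_le (M : Isom m n) (c : m) (y : n) : ‖M.1 c y‖ ≤ 1 := by
  have h := M.sum_star_mul y y
  have h2 : ∑ c, Complex.normSq (M.1 c y) = 1 := by
    have h3 := congrArg Complex.re h
    simpa [Complex.re_sum, ← Complex.normSq_apply] using h3
  have h4 : Complex.normSq (M.1 c y) ≤ 1 := by
    rw [← h2]
    exact Finset.single_le_sum (f := fun c => Complex.normSq (M.1 c y))
      (fun c _ => Complex.normSq_nonneg _) (Finset.mem_univ c)
  rw [Complex.normSq_eq_norm_sq] at h4
  nlinarith [norm_nonneg (M.1 c y)]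

theorem Isom.continuous_entry (c : m) (y : n) : Continuous fun M : Isom m n => M.1 c y :=
  continuous_subtype_val.matrix_elem c y

variable [DecidableEq m]

theorem Isom.continuous_rotate (V : Matrix.unitaryGroup m ℂ) :
    Continuous fun M : Isom m n => Isom.rotate V M := by
  unfold Isom.rotate
  refine Continuous.subtype_mk ?_ _
  fun_prop

variable [Fintype n]

instance instCompactSpaceIsom : CompactSpace (Isom m n) := by
  have hcl : IsClosed {M : Matrix m n ℂ | M.conjTranspose * M = 1} :=
    isClosed_eq (by fun_prop) continuous_const
  have hK : IsCompact (Set.univ.pi fun _ : m => Set.univ.pi fun _ : n =>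
      Metric.closedBall (0 : ℂ) 1) :=
    isCompact_univ_pi fun _ => isCompact_univ_pi fun _ => isCompact_closedBall 0 1
  refine isCompact_iff_compactSpace.mp (IsCompact.of_isClosed_subset hK hcl ?_)
  intro M hM i _ j _
  simpa using Isom.norm_entry_le ⟨M, hM⟩ i j

instance instBorelSpaceIsom : BorelSpace (Isom m n) := Subtype.borelSpace _

instance instSecondCountableTopologyIsom : SecondCountableTopology (Isom m n) :=
  TopologicalSpace.Subtype.secondCountableTopology _

instance instIsProbabilityMeasureHaarUnitary : IsProbabilityMeasure (haarUnitary m) :=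
  ⟨Measure.haarMeasure_self⟩

instance instIsMulLeftInvariantHaarUnitary : (haarUnitary m).IsMulLeftInvariant :=
  Measure.isMulLeftInvariant_haarMeasure _

instance instIsProbabilityMeasureHaarIsometry [h : Nonempty (Isom m n)] :
    IsProbabilityMeasure (haarIsometry m n) := by
  rw [haarIsometry, dif_pos h]
  exact Measure.isProbabilityMeasure_map (Isom.measurable_rotate _).aemeasurable

instance instIsFiniteMeasureHaarIsometry : IsFiniteMeasure (haarIsometry m n) := by
  by_cases h : Nonempty (Isom m n)
  · infer_instance
  · rw [haarIsometry, dif_neg h]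
    infer_instance

/-- Rotating `U M₀` by `V` replaces `U` by `V * U`, so left invariance of Haar measure is inherited
by its image. -/
theorem measurePreserving_rotate (V : Matrix.unitaryGroup m ℂ) :
    MeasurePreserving (fun M : Isom m n => Isom.rotate V M) (haarIsometry m n)
      (haarIsometry m n) := by
  refine ⟨(Isom.continuous_rotate V).measurable, ?_⟩
  by_cases h : Nonempty (Isom m n)
  · rw [haarIsometry, dif_pos h,
      Measure.map_map (Isom.continuous_rotate V).measurable (Isom.measurable_rotate _)]
    have h1 : (fun M : Isom m n => Isom.rotate V M) ∘ (fun U => Isom.rotate U h.some) =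
        (fun U => Isom.rotate U h.some) ∘ fun U => V * U := by
      funext U
      exact Subtype.ext (Matrix.mul_assoc _ _ _).symm
    rw [h1, ← Measure.map_map (Isom.measurable_rotate _) (measurable_const_mul V),
      map_mul_left_eq_self]
  · rw [haarIsometry, dif_neg h, Measure.map_zero]

/-- Without an isometry `haarIsometry` would be the zero measure; the dimension inequalities exclude
this through the present criterion. -/
theorem nonempty_isom (h : Fintype.card n ≤ Fintype.card m) : Nonempty (Isom m n) := by
  obtain ⟨e⟩ := Function.Embedding.nonempty_of_card_le h
  refine ⟨⟨Matrix.of fun a b => if a = e b then 1 else 0, ?_⟩⟩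
  ext a b
  simp [Matrix.mul_apply, Matrix.one_apply, eq_comm]

end Isometries

/-- Compactness of the gate spaces reduces the integrability questions below to continuity. -/
theorem integrable_of_continuous {X E : Type} [TopologicalSpace X] [CompactSpace X]
    [MeasurableSpace X] [OpensMeasurableSpace X] [NormedAddCommGroup E]
    [SecondCountableTopology E] {μ : Measure X} [IsFiniteMeasure μ] {f : X → E}
    (hf : Continuous f) : Integrable f μ :=
  hf.integrable_of_hasCompactSupport (HasCompactSupport.of_compactSpace f)

/-! ### Second moments of Haar-random isometries -/

/-- The tensors that commute with all `V ⊗ V`. -/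
def CommutesWithSquares {m : Type} [Fintype m] [DecidableEq m] (T : m → m → m → m → ℂ) : Prop :=
  ∀ V ∈ Matrix.unitaryGroup m ℂ, ∀ c d a b,
    ∑ c', ∑ d', V c c' * V d d' * T c' d' a b = ∑ a', ∑ b', T c d a' b' * (V a' a * V b' b)

namespace CommutesWithSquares

variable {m : Type} [Fintype m] [DecidableEq m] {T : m → m → m → m → ℂ}

/-- Test with the diagonal unitary that has phase `i` at one index `e` and 1 elsewhere. The phase
`i`, unlike `-1`, has a non-trivial square, so it detects how often `e` occurs among `c, d` and
among `a, b`; the entry vanishes unless these multiplicities agree. -/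
theorem eq_zero (hT : CommutesWithSquares T) {c d a b : m} (h1 : ¬ (c = a ∧ d = b))
    (h2 : ¬ (c = b ∧ d = a)) : T c d a b = 0 := by
  have key : ∀ e : m, (if c = e then Complex.I else 1) * (if d = e then Complex.I else 1) *
      T c d a b = T c d a b * ((if a = e then Complex.I else 1) *
        (if b = e then Complex.I else 1)) := by
    intro e
    have hV : Matrix.diagonal (fun x : m => if x = e then Complex.I else 1) ∈
        Matrix.unitaryGroup m ℂ := by
      rw [Matrix.mem_unitaryGroup_iff, Matrix.star_eq_conjTranspose,
        Matrix.diagonal_conjTranspose, Matrix.diagonal_mul_diagonal, ← Matrix.diagonal_one]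
      congr 1
      funext x
      by_cases hx : x = e <;> simp [hx]
    have := hT _ hV c d a b
    simpa [Matrix.diagonal_apply, Finset.sum_ite_eq, ite_mul, mul_ite] using this
  have hI : Complex.I ≠ 1 := by
    intro h
    simpa using congrArg Complex.re h
  have hc : (c ≠ a ∧ c ≠ b) ∨ (c = a ∧ d ≠ b) ∨ (c = b ∧ d ≠ a) := by tauto
  have fin : ∀ z w : ℂ, z ≠ w → z * T c d a b = T c d a b * w → T c d a b = 0 := by
    intro z w hzw h
    have : (z - w) * T c d a b = 0 := by linear_combination h
    exact (mul_eq_zero.mp this).resolve_left (sub_ne_zero.mpr hzw)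
  have hm1 : (-1 : ℂ) ≠ 1 := by norm_num
  have hI0 := Complex.I_ne_zero
  have hI1 : (-1 : ℂ) ≠ Complex.I := by
    intro h
    simpa using congrArg Complex.re h
  rcases hc with ⟨h, h'⟩ | ⟨rfl, h⟩ | ⟨rfl, h⟩
  · refine fin _ _ ?_ (key c)
    rw [if_pos rfl, if_neg (Ne.symm h), if_neg (Ne.symm h')]
    by_cases hd : d = c <;> simp [hd, hI, hm1]
  · refine fin _ _ ?_ (key d)
    rw [if_pos rfl, if_neg (Ne.symm h)]
    by_cases hd : c = d <;> simp [hd, hI, hI1]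
  · refine fin _ _ ?_ (key d)
    rw [if_pos rfl, if_neg (Ne.symm h)]
    by_cases hd : c = d <;> simp [hd, hI, hI1]

theorem perm (hT : CommutesWithSquares T) (σ : Equiv.Perm m) (c d a b : m) :
    T (σ c) (σ d) (σ a) (σ b) = T c d a b := by
  have hV : (Matrix.of fun x y : m => if σ x = y then (1 : ℂ) else 0) ∈
      Matrix.unitaryGroup m ℂ := by
    rw [Matrix.mem_unitaryGroup_iff]
    ext x y
    simp [Matrix.mul_apply, Matrix.one_apply, Matrix.star_apply]
  have := hT _ hV c d (σ a) (σ b)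
  simpa [ite_mul, mul_ite] using this

theorem perm_pair (hT : CommutesWithSquares T) {c d a b : m} (hcd : c ≠ d) (hab : a ≠ b) :
    T c d c d = T a b a b ∧ T c d d c = T a b b a := by
  obtain ⟨σ, h1, h2⟩ : ∃ σ : Equiv.Perm m, σ a = c ∧ σ b = d := by
    have hw : Equiv.swap a c b ≠ c := by
      intro h
      apply hab
      rw [Equiv.swap_apply_eq_iff, Equiv.swap_apply_right] at h
      exact h.symm
    refine ⟨(Equiv.swap a c).trans (Equiv.swap (Equiv.swap a c b) d), ?_, ?_⟩
    · rw [Equiv.trans_apply, Equiv.swap_apply_left, Equiv.swap_apply_of_ne_of_ne hw.symm hcd]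
    · rw [Equiv.trans_apply, Equiv.swap_apply_left]
  constructor
  · rw [← hT.perm σ a b a b, h1, h2]
  · rw [← hT.perm σ a b b a, h1, h2]

/-- Diagonal and permutation matrices leave `T i i i i` undetermined. A unitary mixing `i` and `j`
ties it to the other two invariants. -/
theorem diag (hT : CommutesWithSquares T) {i j : m} (hij : i ≠ j) :
    T i i i i = T i j i j + T i j j i := by
  -- `V` below is the reflection along `e_i + 2 e_j`, of squared length 5. Its entries `V i i = 3/5`
  -- and `V i j = -4/5` are rational and non-zero.
  set v : m → ℂ := fun x => (if x = i then 1 else 0) + (if x = j then 2 else 0) with hv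
  have hvv : ∑ x, v x * v x = 5 := by
    have : ∀ x, v x * v x = (if x = i then 1 else 0) + (if x = j then 4 else 0) := by
      intro x
      by_cases h : x = i
      · have : x ≠ j := fun h' => hij (h.symm.trans h')
        simp [hv, h, hij]
      · by_cases h' : x = j <;> simp [hv, h, h', hij.symm]; norm_num
    simp only [this, Finset.sum_add_distrib]
    simp
    norm_num
  set V : Matrix m m ℂ := 1 - (2 / 5 : ℂ) • Matrix.vecMulVec v v with hVdef
  have hstar : star V = V := by
    ext x y
    have hsv : ∀ x, (starRingEnd ℂ) (v x) = v x := by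
      intro x
      simp only [hv, map_add, apply_ite (starRingEnd ℂ), map_one, map_zero, Complex.conj_ofNat]
    by_cases hxy : x = y
    · subst hxy
      simp [hVdef, Matrix.star_apply, Matrix.vecMulVec_apply, hsv]
    · simp [hVdef, Matrix.star_apply, Matrix.vecMulVec_apply, hsv, hxy,
        Ne.symm hxy, mul_comm]
  have hsq : Matrix.vecMulVec v v * Matrix.vecMulVec v v = (5 : ℂ) • Matrix.vecMulVec v v := by
    ext x y
    simp only [Matrix.mul_apply, Matrix.vecMulVec_apply, Matrix.smul_apply, smul_eq_mul, ← hvv,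
      Finset.sum_mul]
    exact Finset.sum_congr rfl fun k _ => by ring
  have hV : V ∈ Matrix.unitaryGroup m ℂ := by
    rw [Matrix.mem_unitaryGroup_iff, hstar, hVdef]
    simp only [sub_mul, mul_sub, one_mul, mul_one, smul_mul_assoc, mul_smul_comm, hsq, smul_smul]
    module
  have hii : V i i = 3 / 5 := by
    simp [hVdef, Matrix.vecMulVec_apply, hv, hij]
    norm_num
  have hIJ : V i j = -4 / 5 := by
    simp [hVdef, Matrix.vecMulVec_apply, hv, hij, hij.symm]
    norm_num
  -- At this entry both sides carry the same factor `V i i * V i j = -12/25`, which cancels at the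
  -- end.
  have h := hT V hV i i i j
  have hl : ∑ c', ∑ d', V i c' * V i d' * T c' d' i j =
      V i i * V i j * (T i j i j + T j i i j) := by
    have h0 : ∀ c' d', V i c' * V i d' * T c' d' i j =
        (if c' = i then if d' = j then V i i * V i j * T i j i j else 0 else 0) +
        (if c' = j then if d' = i then V i i * V i j * T j i i j else 0 else 0) := by
      intro c' d'
      by_cases h1 : c' = i ∧ d' = j
      · obtain ⟨rfl, rfl⟩ := h1
        simp [hij]
      · by_cases h2 : c' = j ∧ d' = i
        · obtain ⟨rfl, rfl⟩ := h2
          rw [if_neg hij.symm, if_pos rfl, if_pos rfl, zero_add]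
          ring
        · rw [hT.eq_zero h1 h2, mul_zero, ← ite_and, ← ite_and, if_neg h1, if_neg h2, add_zero]
    rw [Finset.sum_congr rfl fun c' _ => Finset.sum_congr rfl fun d' _ => h0 c' d']
    simp only [Finset.sum_add_distrib]
    simp
    ring
  have hr : ∑ a', ∑ b', T i i a' b' * (V a' i * V b' j) = T i i i i * (V i i * V i j) := by
    have h0 : ∀ a' b', T i i a' b' * (V a' i * V b' j) =
        (if a' = i then if b' = i then T i i i i * (V i i * V i j) else 0 else 0) := by
      intro a' b'
      by_cases h1 : i = a' ∧ i = b'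
      · obtain ⟨rfl, rfl⟩ := h1
        simp
      · rw [hT.eq_zero h1 (fun h => h1 h.symm), zero_mul, ← ite_and,
          if_neg (fun h => h1 ⟨h.1.symm, h.2.symm⟩)]
    rw [Finset.sum_congr rfl fun a' _ => Finset.sum_congr rfl fun b' _ => h0 a' b']
    simp
  rw [hl, hr, hii, hIJ, (hT.perm_pair hij.symm hij).2] at h
  linear_combination (25 / 12 : ℂ) * h

/-- The commutant of the `V ⊗ V` is spanned by the identity and the swap. -/
theorem exists_eq (hT : CommutesWithSquares T) : ∃ α β : ℂ, ∀ c d a b,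
    T c d a b = α * (if c = a ∧ d = b then 1 else 0) + β * (if c = b ∧ d = a then 1 else 0) := by
  by_cases hm : ∃ i j : m, i ≠ j
  · obtain ⟨i, j, hij⟩ := hm
    refine ⟨T i j i j, T i j j i, fun c d a b => ?_⟩
    by_cases h1 : c = a ∧ d = b
    · obtain ⟨rfl, rfl⟩ := h1
      by_cases h2 : c = d
      · subst h2
        obtain ⟨k, hk⟩ : ∃ k, c ≠ k := by
          by_cases hci : c = i
          · exact ⟨j, hci ▸ hij⟩
          · exact ⟨i, hci⟩
        simp [hT.diag hk, (hT.perm_pair hk hij).1, (hT.perm_pair hk hij).2]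
      · simp [h2, (hT.perm_pair h2 hij).1]
    · by_cases h2 : c = b ∧ d = a
      · obtain ⟨rfl, rfl⟩ := h2
        have h3 : c ≠ d := fun h => h1 ⟨h, h.symm⟩
        simp [h3, (hT.perm_pair h3 hij).2]
      · simp [h1, h2, hT.eq_zero h1 h2]
  · push Not at hm
    by_cases hne : Nonempty m
    · obtain ⟨e⟩ := hne
      refine ⟨T e e e e, 0, fun c d a b => ?_⟩
      simp [hm c e, hm d e, hm a e, hm b e]
    · exact ⟨0, 0, fun c => (hne ⟨c⟩).elim⟩

end CommutesWithSquares

section Moment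

variable {m n : Type} [Fintype m] [DecidableEq m] [Fintype n] [DecidableEq n]

/-- The entries of the second moment of a Haar-random isometry. -/
def secondMoment (z z' y y' : n) (c d a b : m) : ℂ :=
  ∫ M : Isom m n, M.1 c z * M.1 d z' * star (M.1 a y) * star (M.1 b y') ∂haarIsometry m n

theorem integrable_moment (z z' y y' : n) (c d a b : m) :
    Integrable (fun M : Isom m n => M.1 c z * M.1 d z' * star (M.1 a y) * star (M.1 b y'))
      (haarIsometry m n) :=
  integrable_of_continuous
    ((((Isom.continuous_entry c z).mul (Isom.continuous_entry d z')).mul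
      (Isom.continuous_entry a y).star).mul (Isom.continuous_entry b y').star)

/-- Substitute `M ↦ V† M` in the Haar integral: the two factors `V` contracted with the unconjugated
entries disappear and reappear on the conjugated ones. -/
theorem commutesWithSquares_secondMoment (z z' y y' : n) :
    CommutesWithSquares (secondMoment (m := m) z z' y y') := by
  intro V hV c d a b
  set W : Matrix.unitaryGroup m ℂ := star ⟨V, hV⟩ with hW
  set φ : Isom m n → ℂ := fun M => (∑ c', V c c' * M.1 c' z) * (∑ d', V d d' * M.1 d' z') *
    star (M.1 a y) * star (M.1 b y') with hφ
  have hφc : Continuous φ :=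
    (((continuous_finsetSum _ fun c' _ => continuous_const.mul (Isom.continuous_entry c' z)).mul
      (continuous_finsetSum _ fun d' _ => continuous_const.mul
        (Isom.continuous_entry d' z'))).mul
      (Isom.continuous_entry a y).star).mul (Isom.continuous_entry b y').star
  have hinv : ∫ M, φ (Isom.rotate W M) ∂haarIsometry m n = ∫ M, φ M ∂haarIsometry m n := by
    have h := integral_map (μ := haarIsometry m n) (Isom.continuous_rotate W).measurable.aemeasurable
      (f := φ) hφc.aestronglyMeasurable
    rw [(measurePreserving_rotate W).map_eq] at h
    exact h.symm
  have hL : ∫ M, φ M ∂haarIsometry m n =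
      ∑ c', ∑ d', V c c' * V d d' * secondMoment z z' y y' c' d' a b := by
    simp only [secondMoment, ← integral_const_mul]
    rw [Finset.sum_congr rfl fun c' _ => (integral_finsetSum _ fun d' _ =>
      (integrable_moment z z' y y' c' d' a b).const_mul _).symm,
      ← integral_finsetSum _ fun c' _ => integrable_finsetSum _ fun d' _ =>
      (integrable_moment z z' y y' c' d' a b).const_mul _]
    congr 1
    funext M
    simp only [hφ]
    rw [Finset.sum_mul_sum]
    simp only [Finset.sum_mul]
    exact Finset.sum_congr rfl fun c' _ => Finset.sum_congr rfl fun d' _ => by ring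
  have hVW : V * W.1 = 1 := Matrix.mem_unitaryGroup_iff.mp hV
  have hR : ∫ M, φ (Isom.rotate W M) ∂haarIsometry m n =
      ∑ a', ∑ b', secondMoment z z' y y' c d a' b' * (V a' a * V b' b) := by
    simp only [secondMoment, ← integral_mul_const]
    rw [Finset.sum_congr rfl fun a' _ => (integral_finsetSum _ fun b' _ =>
      (integrable_moment z z' y y' c d a' b').mul_const _).symm,
      ← integral_finsetSum _ fun a' _ => integrable_finsetSum _ fun b' _ =>
      (integrable_moment z z' y y' c d a' b').mul_const _]
    congr 1
    funext M
    have h1 : ∀ x u, ∑ x', V x x' * (Isom.rotate W M).1 x' u = M.1 x u := by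
      intro x u
      rw [← Matrix.mul_apply]
      change (V * (W.1 * M.1)) x u = M.1 x u
      rw [← Matrix.mul_assoc, hVW, Matrix.one_mul]
    have h2 : ∀ x u, star ((Isom.rotate W M).1 x u) = ∑ x', V x' x * star (M.1 x' u) := by
      intro x u
      change star ((W.1 * M.1) x u) = _
      simp [Matrix.mul_apply, hW, star_sum, Matrix.star_apply, mul_comm]
    simp only [hφ, h1, h2]
    rw [mul_assoc, Finset.sum_mul_sum]
    simp only [Finset.mul_sum]
    exact Finset.sum_congr rfl fun a' _ => Finset.sum_congr rfl fun b' _ => by ring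
  rw [← hL, ← hR, hinv]

variable [Nonempty (Isom m n)]

theorem sum_secondMoment (z z' y y' : n) :
    ∑ c, ∑ d, secondMoment (m := m) z z' y y' c d c d =
      if y = z ∧ y' = z' then 1 else 0 := by
  simp only [secondMoment]
  rw [Finset.sum_congr rfl fun c _ => (integral_finsetSum _ fun d _ =>
    integrable_moment z z' y y' c d c d).symm,
    ← integral_finsetSum _ fun c _ => integrable_finsetSum _ fun d _ =>
    integrable_moment z z' y y' c d c d]
  have : ∀ M : Isom m n, ∑ c, ∑ d, M.1 c z * M.1 d z' * star (M.1 c y) * star (M.1 d y') =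
      if y = z ∧ y' = z' then 1 else 0 := by
    intro M
    have h : (if y = z ∧ y' = z' then (1 : ℂ) else 0) =
      (∑ c, star (M.1 c y) * M.1 c z) * (∑ d, star (M.1 d y') * M.1 d z') := by
      rw [M.sum_star_mul, M.sum_star_mul]
      by_cases h1 : y = z <;> by_cases h2 : y' = z' <;> simp [h1, h2]
    rw [h, Finset.sum_mul_sum]
    exact Finset.sum_congr rfl fun c _ => Finset.sum_congr rfl fun d _ => by ring
  simp only [this, integral_const, probReal_univ, one_smul]

theorem sum_secondMoment_swap (z z' y y' : n) :
    ∑ c, ∑ d, secondMoment (m := m) z z' y y' c d d c =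
      if y = z' ∧ y' = z then 1 else 0 := by
  have h : ∀ c d, secondMoment (m := m) z z' y y' c d d c =
      secondMoment (m := m) z z' y' y c d c d := by
    intro c d
    simp only [secondMoment]
    congr 1
    funext M
    ring
  simp only [h, sum_secondMoment]
  simp only [and_comm]

end Moment

/-! ### The average of a single gate -/

/-- The weight with which a gate cut by the boundary of the region moves the boundary to either
side. -/
def cutWeight (c : ℕ) : ℝ := c / (c ^ 2 + 1)

/-- The average of the transfer weight of a gate that is cut. -/
theorem sum_secondMoment_cut {α : Type} [Fintype α] [DecidableEq α] {c : ℕ}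
    [Nonempty (Isom (Fin c × Fin c) α)] (y₁ y₂ y₃ y₄ : α) :
    (∑ x : Fin c × Fin c, ∑ x' : Fin c × Fin c,
      secondMoment y₁ y₂ y₃ y₄ x x' (x'.1, x.2) (x.1, x'.2) =
      cutWeight c * ((if y₃ = y₁ ∧ y₄ = y₂ then 1 else 0) +
        (if y₃ = y₂ ∧ y₄ = y₁ then 1 else 0))) ∧
    (∑ x : Fin c × Fin c, ∑ x' : Fin c × Fin c,
      secondMoment y₁ y₂ y₃ y₄ x x' (x.1, x'.2) (x'.1, x.2) =
      cutWeight c * ((if y₃ = y₁ ∧ y₄ = y₂ then 1 else 0) +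
        (if y₃ = y₂ ∧ y₄ = y₁ then 1 else 0))) := by
  obtain ⟨a, b, hab⟩ :=
    (commutesWithSquares_secondMoment (m := Fin c × Fin c) y₁ y₂ y₃ y₄).exists_eq
  have h1 := sum_secondMoment (m := Fin c × Fin c) y₁ y₂ y₃ y₄
  have h2 := sum_secondMoment_swap (m := Fin c × Fin c) y₁ y₂ y₃ y₄
  have hpos : ((c : ℂ) ^ 2 + 1) ≠ 0 := by
    have : (0 : ℝ) < (c : ℝ) ^ 2 + 1 := by positivity
    exact_mod_cast this.ne'
  have e1 : ∑ x : Fin c × Fin c, ∑ x' : Fin c × Fin c, secondMoment y₁ y₂ y₃ y₄ x x' x x' =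
      a * c ^ 4 + b * c ^ 2 := by
    simp only [hab, Finset.sum_add_distrib, ← Finset.mul_sum]
    simp [eq_comm]
    ring
  have e2 : ∑ x : Fin c × Fin c, ∑ x' : Fin c × Fin c, secondMoment y₁ y₂ y₃ y₄ x x' x' x =
      a * c ^ 2 + b * c ^ 4 := by
    simp only [hab, Finset.sum_add_distrib, ← Finset.mul_sum]
    simp [eq_comm]
    ring
  have d1 : ∑ x : Fin c × Fin c, ∑ x' : Fin c × Fin c, (if x.1 = x'.1 then (1 : ℂ) else 0) =
      c ^ 3 := by
    have h (x : Fin c × Fin c) :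
        ∑ x' : Fin c × Fin c, (if x.1 = x'.1 then (1 : ℂ) else 0) = c := by
      rw [Fintype.sum_prod_type_right]
      simp
    simp only [h]
    simp
    ring
  have d2 : ∑ x : Fin c × Fin c, ∑ x' : Fin c × Fin c, (if x.2 = x'.2 then (1 : ℂ) else 0) =
      c ^ 3 := by
    have h (x : Fin c × Fin c) :
        ∑ x' : Fin c × Fin c, (if x.2 = x'.2 then (1 : ℂ) else 0) = c := by
      rw [Fintype.sum_prod_type]
      simp
    simp only [h]
    simp
    ring
  have e3 : ∑ x : Fin c × Fin c, ∑ x' : Fin c × Fin c,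
      secondMoment y₁ y₂ y₃ y₄ x x' (x'.1, x.2) (x.1, x'.2) = (a + b) * c ^ 3 := by
    have h (x x' : Fin c × Fin c) : secondMoment y₁ y₂ y₃ y₄ x x' (x'.1, x.2) (x.1, x'.2) =
        a * (if x.1 = x'.1 then 1 else 0) + b * (if x.2 = x'.2 then 1 else 0) := by
      rw [hab]
      congr 3 <;> simp [Prod.ext_iff, eq_comm]
    simp only [h, Finset.sum_add_distrib, ← Finset.mul_sum, d1, d2]
    ring
  have e4 : ∑ x : Fin c × Fin c, ∑ x' : Fin c × Fin c,
      secondMoment y₁ y₂ y₃ y₄ x x' (x.1, x'.2) (x'.1, x.2) = (a + b) * c ^ 3 := by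
    have h (x x' : Fin c × Fin c) : secondMoment y₁ y₂ y₃ y₄ x x' (x.1, x'.2) (x'.1, x.2) =
        a * (if x.2 = x'.2 then 1 else 0) + b * (if x.1 = x'.1 then 1 else 0) := by
      rw [hab]
      congr 3 <;> simp [Prod.ext_iff, eq_comm]
    simp only [h, Finset.sum_add_distrib, ← Finset.mul_sum, d1, d2]
    ring
  -- Only `a + b` matters: adding the two trace identities gives `(a + b) * (c⁴ + c²)`, so the ratio
  -- is `c³ / (c⁴ + c²)`. This is the origin of `cutWeight`.
  have key : (a + b) * (c : ℂ) ^ 3 = cutWeight c * ((if y₃ = y₁ ∧ y₄ = y₂ then 1 else 0) +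
        (if y₃ = y₂ ∧ y₄ = y₁ then 1 else 0)) := by
    rw [← h1, ← h2, e1, e2, cutWeight]
    push_cast
    field_simp
    ring
  exact ⟨e3.trans key, e4.trans key⟩

/-- The weight with which an averaged gate puts its input site into the region, where `a` and `b`
tell whether its output sites belong to the region. -/
def inWeight (c : ℕ) (a b : Prop) [Decidable a] [Decidable b] : ℝ :=
  if a then (if b then 1 else cutWeight c) else (if b then cutWeight c else 0)

/-- The weight with which an averaged gate leaves its input site out of the region. -/
def outWeight (c : ℕ) (a b : Prop) [Decidable a] [Decidable b] : ℝ :=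
  if a then (if b then 0 else cutWeight c) else (if b then cutWeight c else 1)

theorem continuous_gateWeight {α β : Type} [Fintype α] [DecidableEq α] [Fintype β] [DecidableEq β]
    (a b : Prop) [Decidable a] [Decidable b] (y₁ y₂ y₃ y₄ : α) :
    Continuous fun M : Isom (β × β) α => gateWeight a b M.1 y₁ y₂ y₃ y₄ :=
  continuous_finsetSum _ fun _ _ => continuous_finsetSum _ fun _ _ =>
    (((Isom.continuous_entry _ y₁).mul (Isom.continuous_entry _ y₂)).mul
      (Isom.continuous_entry _ y₃).star).mul (Isom.continuous_entry _ y₄).star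

/-- For an uncut gate the contraction is the full trace of the second moment, straight or swapped,
and `M† M = 1` evaluates it. Only a cut gate needs the commutant. -/
theorem integral_gateWeight {α : Type} [Fintype α] [DecidableEq α] {c : ℕ}
    [Nonempty (Isom (Fin c × Fin c) α)] (a b : Prop) [Decidable a] [Decidable b]
    (y₁ y₂ y₃ y₄ : α) :
    ∫ M : Isom (Fin c × Fin c) α, gateWeight a b M.1 y₁ y₂ y₃ y₄ ∂haarIsometry _ _ =
      inWeight c a b * (if y₃ = y₂ ∧ y₄ = y₁ then 1 else 0) +
      outWeight c a b * (if y₃ = y₁ ∧ y₄ = y₂ then 1 else 0) := by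
  simp only [gateWeight]
  rw [integral_finsetSum _ fun x _ => integrable_finsetSum _ fun x' _ => integrable_moment _ _ _ _ _ _ _ _,
    Finset.sum_congr rfl fun x _ => integral_finsetSum _ fun x' _ => integrable_moment _ _ _ _ _ _ _ _]
  have h1 := sum_secondMoment (m := Fin c × Fin c) y₁ y₂ y₃ y₄
  have h2 := sum_secondMoment_swap (m := Fin c × Fin c) y₁ y₂ y₃ y₄
  have h3 := sum_secondMoment_cut (c := c) y₁ y₂ y₃ y₄
  by_cases ha : a <;> by_cases hb : b
  · simp only [ha, hb, if_true, inWeight, outWeight]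
    simpa [secondMoment] using h2
  · simp only [ha, hb, if_true, if_false, inWeight, outWeight]
    rw [← mul_add, add_comm]
    exact h3.1
  · simp only [ha, hb, if_true, if_false, inWeight, outWeight]
    rw [← mul_add, add_comm]
    exact h3.2
  · simp only [ha, hb, if_false, inWeight, outWeight]
    simpa [secondMoment] using h1

/-! ### The average of a layer of gates -/

/-- The weight in the average purity of a region `A` after a layer of random gates of the region
`B` before the layer. -/
def layerWeight {P S : Type} [Fintype P] [DecidableEq P] [DecidableEq S] (c : ℕ) (l r : P → S)
    (A : Finset S) (B : Finset P) : ℝ :=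
  ∏ p, if p ∈ B then inWeight c (l p ∈ A) (r p ∈ A) else outWeight c (l p ∈ A) (r p ∈ A)

/-- By independence the average of the product of gate weights is the product of averages, each a
sum of an "in" and an "out" term. -/
theorem integral_purity_layer {P S α : Type} [Fintype P] [DecidableEq P] [Fintype S]
    [DecidableEq S] [Fintype α] [DecidableEq α] {c : ℕ} [Nonempty (Isom (Fin c × Fin c) α)]
    {l r : P → S} (h : Function.Bijective (Sum.elim l r)) (Φ : (P → α) → ℂ) (A : Finset S) :
    ∫ w : P → Isom (Fin c × Fin c) α, purity (layer l r (fun p => (w p).1) Φ) A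
        ∂(Measure.pi fun _ => haarIsometry _ _) =
      ∑ B : Finset P, layerWeight c l r A B * purity Φ B := by
  simp only [purity_layer h]
  have hc : ∀ y₁ y₂ y₃ y₄ : P → α, Integrable (fun w : P → Isom (Fin c × Fin c) α =>
      Φ y₁ * Φ y₂ * star (Φ y₃) * star (Φ y₄) *
        ∏ p, gateWeight (l p ∈ A) (r p ∈ A) (w p).1 (y₁ p) (y₂ p) (y₃ p) (y₄ p))
      (Measure.pi fun _ => haarIsometry (Fin c × Fin c) α) := fun y₁ y₂ y₃ y₄ =>
    integrable_of_continuous (continuous_const.mul (continuous_finsetProd _ fun p _ =>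
      (continuous_gateWeight _ _ _ _ _ _).comp (continuous_apply p)))
  rw [integral_finsetSum _ fun y₁ _ => integrable_finsetSum _ fun y₂ _ =>
    integrable_finsetSum _ fun y₃ _ => integrable_finsetSum _ fun y₄ _ => hc y₁ y₂ y₃ y₄,
    Finset.sum_congr rfl fun y₁ _ => integral_finsetSum _ fun y₂ _ =>
    integrable_finsetSum _ fun y₃ _ => integrable_finsetSum _ fun y₄ _ => hc y₁ y₂ y₃ y₄,
    Finset.sum_congr rfl fun y₁ _ => Finset.sum_congr rfl fun y₂ _ => integral_finsetSum _
      fun y₃ _ => integrable_finsetSum _ fun y₄ _ => hc y₁ y₂ y₃ y₄,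
    Finset.sum_congr rfl fun y₁ _ => Finset.sum_congr rfl fun y₂ _ =>
      Finset.sum_congr rfl fun y₃ _ => integral_finsetSum _ fun y₄ _ => hc y₁ y₂ y₃ y₄]
  have hprod : ∀ y₁ y₂ y₃ y₄ : P → α,
      ∫ w : P → Isom (Fin c × Fin c) α, Φ y₁ * Φ y₂ * star (Φ y₃) * star (Φ y₄) *
        ∏ p, gateWeight (l p ∈ A) (r p ∈ A) (w p).1 (y₁ p) (y₂ p) (y₃ p) (y₄ p)
        ∂(Measure.pi fun _ => haarIsometry (Fin c × Fin c) α) =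
      ∑ B : Finset P, layerWeight c l r A B * (Φ y₁ * Φ y₂ * star (Φ y₃) * star (Φ y₄) *
        ∏ p, if p ∈ B then (if y₃ p = y₂ p ∧ y₄ p = y₁ p then (1 : ℂ) else 0)
          else (if y₃ p = y₁ p ∧ y₄ p = y₂ p then 1 else 0)) := by
    intro y₁ y₂ y₃ y₄
    rw [integral_const_mul, integral_fintype_prod_eq_prod (fun p (M : Isom (Fin c × Fin c) α) =>
      gateWeight (l p ∈ A) (r p ∈ A) M.1 (y₁ p) (y₂ p) (y₃ p) (y₄ p))]
    simp only [integral_gateWeight]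
    -- Expanding the product, `B` is the set of gates for which the "in" term is chosen; its deltas
    -- are those of the purity of `B`.
    rw [Finset.prod_add, Finset.mul_sum, Finset.powerset_univ]
    refine Finset.sum_congr rfl fun B _ => ?_
    have hB := Finset.prod_piecewise Finset.univ B
      (fun p => (inWeight c (l p ∈ A) (r p ∈ A) : ℂ) *
        if y₃ p = y₂ p ∧ y₄ p = y₁ p then 1 else 0)
      (fun p => (outWeight c (l p ∈ A) (r p ∈ A) : ℂ) *
        if y₃ p = y₁ p ∧ y₄ p = y₂ p then 1 else 0)
    rw [Finset.univ_inter] at hB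
    rw [← hB, mul_left_comm, layerWeight, Complex.ofReal_prod, ← Finset.prod_mul_distrib]
    congr 1
    refine Finset.prod_congr rfl fun p _ => ?_
    by_cases hp : p ∈ B <;> simp [hp]
  simp only [hprod, purity_eq_sum_prod, Finset.mul_sum (ι := P → α)]
  have := Finset.sum_comm (s := (Finset.univ : Finset (Finset P)))
    (t := (Finset.univ : Finset ((P → α) × (P → α) × (P → α) × (P → α))))
    (f := fun B y => layerWeight c l r A B * (Φ y.1 * Φ y.2.1 * star (Φ y.2.2.1) *
      star (Φ y.2.2.2) * ∏ p, if p ∈ B then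
        (if y.2.2.1 p = y.2.1 p ∧ y.2.2.2 p = y.1 p then (1 : ℂ) else 0)
          else (if y.2.2.1 p = y.1 p ∧ y.2.2.2 p = y.2.1 p then 1 else 0)))
  simpa only [Fintype.sum_prod_type] using this.symm

theorem integral_purity_layer_re {P S α : Type} [Fintype P] [DecidableEq P] [Fintype S]
    [DecidableEq S] [Fintype α] [DecidableEq α] {c : ℕ} [Nonempty (Isom (Fin c × Fin c) α)]
    {l r : P → S} (h : Function.Bijective (Sum.elim l r)) (Φ : (P → α) → ℂ) (A : Finset S) :
    ∫ w : P → Isom (Fin c × Fin c) α, (purity (layer l r (fun p => (w p).1) Φ) A).re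
        ∂(Measure.pi fun _ => haarIsometry _ _) =
      ∑ B : Finset P, layerWeight c l r A B * (purity Φ B).re := by
  have hi : Integrable (fun w : P → Isom (Fin c × Fin c) α =>
      purity (layer l r (fun p => (w p).1) Φ) A) (Measure.pi fun _ => haarIsometry _ _) := by
    simp only [purity_layer h]
    refine integrable_of_continuous (continuous_finsetSum _ fun y₁ _ => continuous_finsetSum _
      fun y₂ _ => continuous_finsetSum _ fun y₃ _ => continuous_finsetSum _ fun y₄ _ =>
      continuous_const.mul (continuous_finsetProd _ fun p _ =>
      (continuous_gateWeight _ _ _ _ _ _).comp (continuous_apply p)))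
  have h1 := Complex.reCLM.integral_comp_comm hi
  rw [integral_purity_layer h] at h1
  simpa [Complex.re_sum] using h1

/-- A layer of isometries preserves the norm. -/
theorem purity_layer_empty {P S α β : Type} [Fintype P] [DecidableEq P] [Fintype S]
    [DecidableEq S] [Fintype α] [DecidableEq α] [Fintype β]
    {l r : P → S} (h : Function.Bijective (Sum.elim l r)) (w : P → Isom (β × β) α)
    (Φ : (P → α) → ℂ) : purity (layer l r (fun p => (w p).1) Φ) ∅ = purity Φ ∅ := by
  rw [purity_layer h, purity_eq_sum_prod]
  refine Finset.sum_congr rfl fun y₁ _ => Finset.sum_congr rfl fun y₂ _ =>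
    Finset.sum_congr rfl fun y₃ _ => Finset.sum_congr rfl fun y₄ _ => ?_
  congr 1
  refine Finset.prod_congr rfl fun p _ => ?_
  have e1 := (w p).sum_star_mul (y₃ p) (y₁ p)
  have e2 := (w p).sum_star_mul (y₄ p) (y₂ p)
  have e3 : (if y₃ p = y₁ p ∧ y₄ p = y₂ p then (1 : ℂ) else 0) =
      (∑ c, star ((w p).1 c (y₃ p)) * (w p).1 c (y₁ p)) *
        ∑ c, star ((w p).1 c (y₄ p)) * (w p).1 c (y₂ p) := by
    rw [e1, e2]
    by_cases h1 : y₃ p = y₁ p <;> by_cases h2 : y₄ p = y₂ p <;> simp [h1, h2]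
  simp only [gateWeight, Finset.notMem_empty, if_false]
  rw [e3, Finset.sum_mul_sum]
  exact Finset.sum_congr rfl fun x _ => Finset.sum_congr rfl fun x' _ => by ring

/-! ### The pairs of sites on the ring -/

/-- The `t`-shifted first child of the site `p`. -/
def childSite (t k : ℕ) (p : Site k) : Site (k + 1) := ((2 * p.val + t : ℕ) : Site (k + 1))

/-- Changing `q` by a multiple of `2 ^ k` changes `2 * q + t` by a multiple of `2 ^ (k + 1)`, so
children can be computed on integer representatives. -/
theorem childSite_intCast (t k : ℕ) (q : ℤ) :
    childSite t k (q : Site k) = ((2 * q + t : ℤ) : Site (k + 1)) := by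
  have h : ((2 * ((q : Site k)).val + t : ℕ) : Site (k + 1)) =
      ((2 * (((q : Site k)).val : ℤ) + t : ℤ) : Site (k + 1)) := by push_cast; rfl
  rw [childSite, h, ZMod.val_intCast, ZMod.intCast_eq_intCast_iff_dvd_sub]
  refine ⟨q / 2 ^ k, ?_⟩
  have := Int.emod_add_mul_ediv q (2 ^ k)
  push_cast
  rw [pow_succ]
  linear_combination 2 * this.symm

theorem bijective_childSite (t k : ℕ) :
    Function.Bijective (Sum.elim (childSite t k) (childSite (t + 1) k)) := by
  rw [Fintype.bijective_iff_surjective_and_card]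
  refine ⟨fun s => ?_, ?_⟩
  · obtain ⟨z, rfl⟩ := ZMod.intCast_surjective s
    rcases Int.emod_two_eq_zero_or_one (z - t) with h | h
    · refine ⟨Sum.inl (((z - t) / 2 : ℤ) : Site k), ?_⟩
      rw [Sum.elim_inl, childSite_intCast]
      congr 1
      omega
    · refine ⟨Sum.inr (((z - t) / 2 : ℤ) : Site k), ?_⟩
      rw [Sum.elim_inr, childSite_intCast]
      congr 1
      push_cast
      omega
  · rw [Fintype.card_sum, ZMod.card, ZMod.card, pow_succ, mul_two]

/-- The input of a layer `W`, as a state of pairs of sites. -/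
def pairState {k b : ℕ} (φ : State (Site (k + 1)) b) : (Site k → Fin b × Fin b) → ℂ := fun y =>
  φ ((pairEquiv (bijective_childSite 1 k)).symm y)

/-- The region `A` is a union of whole pairs, so exchanging replicas on it is exchanging them pair
by pair. -/
theorem purity_pairState {k b : ℕ} (φ : State (Site (k + 1)) b) {A : Finset (Site (k + 1))}
    {B : Finset (Site k)} (hl : ∀ p, childSite 1 k p ∈ A ↔ p ∈ B)
    (hr : ∀ p, childSite 2 k p ∈ A ↔ p ∈ B) : purity (pairState φ) B = purity φ A := by
  unfold purity pairState
  set e := pairEquiv (β := Fin b) (bijective_childSite 1 k) with he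
  have hp : ∀ x y, e.symm (B.piecewise (e x) (e y)) = A.piecewise x y := by
    intro x y
    rw [Equiv.symm_apply_eq]
    funext p
    by_cases hB : p ∈ B <;> simp [he, pairEquiv, Finset.piecewise, hl, hr, hB]
  rw [← e.sum_comp]
  refine Finset.sum_congr rfl fun x _ => ?_
  rw [← e.sum_comp]
  refine Finset.sum_congr rfl fun y _ => ?_
  rw [hp, hp, e.symm_apply_apply, e.symm_apply_apply]

theorem applyV_eq_layer {k a b : ℕ} (v : Site k → Isom (Fin b × Fin b) (Fin a))
    (ψ : State (Site k) a) :
    applyV v ψ = layer (childSite 0 k) (childSite 1 k) (fun p => (v p).1) ψ := rfl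

theorem applyW_eq_layer {k b c : ℕ} (w : Site k → Isom (Fin c × Fin c) (Fin b × Fin b))
    (φ : State (Site (k + 1)) b) :
    applyW w φ = layer (childSite 1 k) (childSite 2 k) (fun p => (w p).1) (pairState φ) := by
  funext x
  unfold applyW layer pairState
  rw [← (pairEquiv (bijective_childSite 1 k)).sum_comp]
  refine Finset.sum_congr rfl fun y _ => ?_
  rw [Equiv.symm_apply_apply]
  rfl

/-! ### The random network -/

section Network

variable {L : ℕ} {D D' : ℕ → ℕ}

instance instSecondCountableTopologyGates : SecondCountableTopology (Gates L D D') :=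
  inferInstance

instance instOpensMeasurableSpaceGates : OpensMeasurableSpace (Gates L D D') := inferInstance

theorem purity_psi_empty (hD : D 0 = 1) (g : Gates L D D') :
    ∀ (k : ℕ) (hk : k ≤ L), purity (psi g k hk) ∅ = 1
  | 0, _ => by
    rw [purity_empty]
    simp [psi, hD]
  | k + 1, hk => by
    rw [psi, applyW_eq_layer, purity_layer_empty (bijective_childSite 1 k),
      purity_pairState (A := ∅) _ (by simp) (by simp), applyV_eq_layer,
      purity_layer_empty (bijective_childSite 0 k), purity_psi_empty hD g k]

theorem purity_phi_empty (hD : D 0 = 1) (g : Gates L D D') (k : ℕ) (hk : k < L) :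
    purity (phi g k hk) ∅ = 1 := by
  rw [phi, applyV_eq_layer, purity_layer_empty (bijective_childSite 0 k), purity_psi_empty hD]

theorem continuous_psi : ∀ (k : ℕ) (hk : k ≤ L) (x : Site k → Fin (D k)),
    Continuous fun g : Gates L D D' => psi g k hk x
  | 0, _, _ => continuous_const
  | k + 1, hk, x => by
    simp only [psi, applyW, applyV]
    refine continuous_finsetSum _ fun y _ => (continuous_finsetProd _ fun p _ => ?_).mul
      (continuous_finsetSum _ fun z _ => (continuous_finsetProd _ fun p _ => ?_).mul
        (continuous_psi k _ z))
    · exact (Isom.continuous_entry _ _).comp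
        ((continuous_apply p).comp (continuous_snd.comp (continuous_apply _)))
    · exact (Isom.continuous_entry _ _).comp
        ((continuous_apply p).comp (continuous_fst.comp (continuous_apply _)))

theorem continuous_phi (k : ℕ) (hk : k < L) (x : Site (k + 1) → Fin (D' (k + 1))) :
    Continuous fun g : Gates L D D' => phi g k hk x := by
  simp only [phi, applyV]
  refine continuous_finsetSum _ fun z _ => (continuous_finsetProd _ fun p _ => ?_).mul
    (continuous_psi k _ z)
  exact (Isom.continuous_entry _ _).comp
    ((continuous_apply p).comp (continuous_fst.comp (continuous_apply _)))

theorem continuous_purity {X S α : Type} [TopologicalSpace X] [Fintype S] [DecidableEq S]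
    [Fintype α] {f : X → (S → α) → ℂ} (hf : ∀ x, Continuous fun g => f g x) (A : Finset S) :
    Continuous fun g => (purity (f g) A).re :=
  Complex.continuous_re.comp (continuous_finsetSum _ fun _ _ => continuous_finsetSum _ fun _ _ =>
    (((hf _).mul (hf _)).mul (hf _).star).mul (hf _).star)

/-- Row `j` involves only gates with index below `j`, so resampling a later level leaves it fixed.
-/
theorem psi_update (g : Gates L D D') (k : Fin L) (u) :
    ∀ (j : ℕ) (hj : j ≤ L), j ≤ k → psi (Function.update g k u) j hj = psi g j hj
  | 0, _, _ => rfl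
  | j + 1, hj, hjk => by
    have hne : (⟨j, hj⟩ : Fin L) ≠ k := fun h => by
      have := congrArg Fin.val h
      simp only at this
      omega
    simp only [psi, Function.update_of_ne hne]
    rw [psi_update g k u j _ (by omega)]

/-- Resampling one coordinate independently does not change a product law. This lets one level be
averaged with the rest held fixed. -/
theorem measurePreserving_update {ι : Type} [Fintype ι] [DecidableEq ι] {X : ι → Type}
    [∀ i, MeasurableSpace (X i)] (μ : ∀ i, Measure (X i)) [∀ i, IsProbabilityMeasure (μ i)]
    (k : ι) : MeasurePreserving (fun q : (∀ i, X i) × X k => Function.update q.1 k q.2)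
      ((Measure.pi μ).prod (μ k)) (Measure.pi μ) := by
  have hm : Measurable (fun q : (∀ i, X i) × X k => Function.update q.1 k q.2) := by
    refine measurable_pi_lambda _ fun i => ?_
    by_cases h : i = k
    · subst h
      simpa using measurable_snd
    · simp only [Function.update_of_ne h]
      exact (measurable_pi_apply i).comp measurable_fst
  refine ⟨hm, (Measure.pi_eq fun s hs => ?_).symm⟩
  rw [Measure.map_apply hm (MeasurableSet.univ_pi hs)]
  have hpre : (fun q : (∀ i, X i) × X k => Function.update q.1 k q.2) ⁻¹' Set.univ.pi s =
      (Set.univ.pi (Function.update s k Set.univ)) ×ˢ s k := by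
    ext q
    simp only [Set.mem_preimage, Set.mem_pi, Set.mem_univ, true_imp_iff, Set.mem_prod]
    constructor
    · intro h
      refine ⟨fun i => ?_, by simpa using h k⟩
      by_cases hi : i = k
      · subst hi
        simp
      · simpa [Function.update_of_ne hi] using h i
    · rintro ⟨h1, h2⟩ i
      by_cases hi : i = k
      · subst hi
        simpa using h2
      · simpa [Function.update_of_ne hi] using h1 i
  rw [hpre, Measure.prod_prod, Measure.pi_pi, ← Finset.mul_prod_erase _ _ (Finset.mem_univ k),
    ← Finset.mul_prod_erase Finset.univ (fun i => μ i (s i)) (Finset.mem_univ k)]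
  simp only [Function.update_self, measure_univ, one_mul]
  rw [mul_comm]
  congr 1
  refine Finset.prod_congr rfl fun i hi => ?_
  rw [Function.update_of_ne (Finset.ne_of_mem_erase hi)]

/-! ### Averaging the purity over one level -/

/-- The dimensions allow for isometries. -/
def Admissible (L : ℕ) (D D' : ℕ → ℕ) : Prop :=
  ∀ k < L, D k ≤ D' (k + 1) ^ 2 ∧ D' (k + 1) ≤ D (k + 1)

theorem Admissible.nonempty_V (h : Admissible L D D') {k : ℕ} (hk : k < L) :
    Nonempty (Isom (Fin (D' (k + 1)) × Fin (D' (k + 1))) (Fin (D k))) :=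
  nonempty_isom (by simpa [sq] using (h k hk).1)

theorem Admissible.nonempty_W (h : Admissible L D D') {k : ℕ} (hk : k < L) :
    Nonempty (Isom (Fin (D (k + 1)) × Fin (D (k + 1)))
      (Fin (D' (k + 1)) × Fin (D' (k + 1)))) :=
  nonempty_isom (by simpa using Nat.mul_le_mul (h k hk).2 (h k hk).2)

/-- The law of the isometries of a level. -/
def levelLaw (D D' : ℕ → ℕ) (k : ℕ) : Measure
    ((Site k → Isom (Fin (D' (k + 1)) × Fin (D' (k + 1))) (Fin (D k))) ×
    (Site k → Isom (Fin (D (k + 1)) × Fin (D (k + 1))) (Fin (D' (k + 1)) × Fin (D' (k + 1))))) :=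
  (Measure.pi fun _ => haarIsometry _ _).prod (Measure.pi fun _ => haarIsometry _ _)

theorem meraLaw_eq : meraLaw L D D' = Measure.pi fun k : Fin L => levelLaw D D' k := rfl

theorem Admissible.isProbabilityMeasure_levelLaw (h : Admissible L D D') (k : Fin L) :
    IsProbabilityMeasure (levelLaw D D' k) := by
  have := h.nonempty_V k.2
  have := h.nonempty_W k.2
  unfold levelLaw
  infer_instance

theorem Admissible.isProbabilityMeasure_meraLaw (h : Admissible L D D') :
    IsProbabilityMeasure (meraLaw L D D') := by
  have := h.isProbabilityMeasure_levelLaw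
  rw [meraLaw_eq]
  infer_instance

theorem Admissible.integral_eq_integral_update (h : Admissible L D D') (k : Fin L)
    {f : Gates L D D' → ℝ} (hf : Continuous f) :
    ∫ g, f g ∂meraLaw L D D' =
      ∫ g, ∫ u, f (Function.update g k u) ∂levelLaw D D' k ∂meraLaw L D D' := by
  have := h.isProbabilityMeasure_levelLaw
  have := h.isProbabilityMeasure_meraLaw
  have hp := measurePreserving_update (fun k : Fin L => levelLaw D D' k) k
  rw [← meraLaw_eq] at hp
  have h1 := integral_map (μ := (meraLaw L D D').prod (levelLaw D D' k)) hp.measurable.aemeasurable (f := f) hf.aestronglyMeasurable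
  rw [hp.map_eq] at h1
  rw [h1, integral_prod]
  have hc : Continuous fun q : Gates L D D' × _ => f (Function.update q.1 k q.2) :=
    hf.comp (continuous_fst.update k continuous_snd)
  exact integrable_of_continuous hc

theorem Admissible.integral_purity_phi (h : Admissible L D D') (k : ℕ) (hk : k < L)
    (A : Finset (Site (k + 1))) :
    ∫ g, (purity (phi g k hk) A).re ∂meraLaw L D D' =
      ∑ B, layerWeight (D' (k + 1)) (childSite 0 k) (childSite 1 k) A B *
        ∫ g, (purity (psi g k hk.le) B).re ∂meraLaw L D D' := by
  have := h.nonempty_V hk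
  have := h.nonempty_W hk
  have := h.isProbabilityMeasure_meraLaw
  rw [h.integral_eq_integral_update ⟨k, hk⟩ (continuous_purity (continuous_phi k hk) A)]
  have h1 : ∀ g : Gates L D D', ∫ u, (purity (phi (Function.update g ⟨k, hk⟩ u) k hk) A).re
      ∂levelLaw D D' k = ∑ B, layerWeight (D' (k + 1)) (childSite 0 k) (childSite 1 k) A B *
        (purity (psi g k hk.le) B).re := by
    intro g
    rw [← integral_purity_layer_re (bijective_childSite 0 k)]
    have h2 : ∀ u, phi (Function.update g ⟨k, hk⟩ u) k hk = applyV u.1 (psi g k hk.le) := by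
      intro u
      rw [phi, psi_update g ⟨k, hk⟩ u k _ le_rfl, Function.update_self]
    simp only [h2]
    exact (integral_fun_fst (fun v => (purity (applyV v (psi g k hk.le)) A).re)).trans (by
      rw [probReal_univ, one_smul]; rfl)
  simp only [h1]
  rw [integral_finsetSum _ fun B _ => (integrable_of_continuous
    (continuous_purity (continuous_psi k _) B)).const_mul _]
  simp only [integral_const_mul]

theorem Admissible.integral_purity_psi (h : Admissible L D D') (k : ℕ) (hk : k < L)
    (A : Finset (Site (k + 1))) :
    ∫ g, (purity (psi g (k + 1) hk) A).re ∂meraLaw L D D' =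
      ∑ B, layerWeight (D (k + 1)) (childSite 1 k) (childSite 2 k) A B *
        ∫ g, (purity (pairState (phi g k hk)) B).re ∂meraLaw L D D' := by
  have := h.nonempty_V hk
  have := h.nonempty_W hk
  have := h.isProbabilityMeasure_meraLaw
  have hc : ∀ B, Continuous fun g : Gates L D D' => (purity (pairState (phi g k hk)) B).re :=
    fun B => continuous_purity (fun x => continuous_phi k hk _) B
  have hsum : ∫ g, ∑ B, layerWeight (D (k + 1)) (childSite 1 k) (childSite 2 k) A B *
      (purity (pairState (phi g k hk)) B).re ∂meraLaw L D D' =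
      ∑ B, layerWeight (D (k + 1)) (childSite 1 k) (childSite 2 k) A B *
        ∫ g, (purity (pairState (phi g k hk)) B).re ∂meraLaw L D D' := by
    rw [integral_finsetSum _ fun B _ => (integrable_of_continuous (hc B)).const_mul _]
    simp only [integral_const_mul]
  -- The state before `W` depends on the `V` gates of the same level. So both sides are averaged
  -- over the whole level, and the layer formula is applied to the integral over `w` with `v` fixed.
  rw [← hsum, h.integral_eq_integral_update ⟨k, hk⟩ (continuous_purity (continuous_psi _ hk) A),
    h.integral_eq_integral_update ⟨k, hk⟩ (f := fun g => ∑ B,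
      layerWeight (D (k + 1)) (childSite 1 k) (childSite 2 k) A B *
        (purity (pairState (phi g k hk)) B).re)
      (continuous_finsetSum _ fun B _ => continuous_const.mul (hc B))]
  congr 1
  funext g
  have hphi : ∀ u, phi (Function.update g ⟨k, hk⟩ u) k hk = applyV u.1 (psi g k hk.le) := by
    intro u
    rw [phi, psi_update g ⟨k, hk⟩ u k _ le_rfl, Function.update_self]
  have hpsi : ∀ u, psi (Function.update g ⟨k, hk⟩ u) (k + 1) hk =
      applyW u.2 (applyV u.1 (psi g k hk.le)) := by
    intro u
    rw [psi, psi_update g ⟨k, hk⟩ u k _ le_rfl, Function.update_self]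
  have hcu : Continuous fun u => Function.update g ⟨k, hk⟩ u := continuous_const.update _ continuous_id
  have hi1 : Integrable (fun u => (purity (psi (Function.update g ⟨k, hk⟩ u) (k + 1) hk) A).re)
      (levelLaw D D' k) := by
    unfold levelLaw
    exact integrable_of_continuous ((continuous_purity (continuous_psi _ hk) A).comp hcu)
  simp only [hphi]
  rw [levelLaw, integral_fun_fst (fun v => ∑ B,
    layerWeight (D (k + 1)) (childSite 1 k) (childSite 2 k) A B *
      (purity (pairState (applyV v (psi g k hk.le))) B).re), probReal_univ, one_smul]
  rw [levelLaw] at hi1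
  rw [integral_prod _ hi1]
  congr 1
  funext v
  rw [← integral_purity_layer_re (bijective_childSite 1 k)]
  simp only [hpsi, applyW_eq_layer]

end Network

/-! ### Intervals on the ring -/

theorem intCast_mem_interval {k : ℕ} {i j z : ℤ} :
    (z : Site k) ∈ interval k i j ↔ (z - i) % 2 ^ k ≤ j - i := by
  have hN : (0 : ℤ) < 2 ^ k := by positivity
  rw [interval, Finset.mem_image]
  constructor
  · rintro ⟨w, hw, hwz⟩
    rw [Finset.mem_Icc] at hw
    rw [ZMod.intCast_eq_intCast_iff] at hwz
    have h1 : (z - i) % 2 ^ k = (w - i) % 2 ^ k := by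
      have := (hwz.sub_right i).symm
      push_cast at this
      exact this
    rw [h1]
    have h2 := Int.emod_add_mul_ediv (w - i) (2 ^ k)
    have h3 : 0 ≤ (w - i) / 2 ^ k := Int.ediv_nonneg (by omega) hN.le
    nlinarith
  · intro h
    refine ⟨i + (z - i) % 2 ^ k, ?_, ?_⟩
    · rw [Finset.mem_Icc]
      have := Int.emod_nonneg (z - i) hN.ne'
      omega
    · rw [ZMod.intCast_eq_intCast_iff_dvd_sub]
      refine ⟨(z - i) / 2 ^ k, ?_⟩
      have h2 := Int.emod_add_mul_ediv (z - i) (2 ^ k)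
      push_cast
      linarith

/-- In this window `z - i` is its own residue, except at `z = i - 1`, whose residue `2 ^ k - 1`
exceeds `j - i` when at least one site is missing. That extra point is needed for the pair
straddling the left endpoint. -/
theorem intCast_mem_interval_of_le {k : ℕ} {i j z : ℤ} (h1 : i ≤ z ∨ (z = i - 1 ∧ j - i ≤ 2 ^ k - 2))
    (h2 : z ≤ i + 2 ^ k - 1) : (z : Site k) ∈ interval k i j ↔ i ≤ z ∧ z ≤ j := by
  have hN : (0 : ℤ) < 2 ^ k := by positivity
  rw [intCast_mem_interval]
  rcases h1 with h1 | ⟨rfl, h1⟩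
  · rw [Int.emod_eq_of_lt (by omega) (by omega)]
    omega
  · have : (i - 1 - i) % 2 ^ k = 2 ^ k - 1 := by
      rw [← Int.add_emod_right, Int.emod_eq_of_lt (by omega) (by omega)]
      omega
    rw [this]
    omega

theorem exists_intCast_eq {k : ℕ} (a : ℤ) (p : Site k) :
    ∃ q : ℤ, a ≤ q ∧ q ≤ a + 2 ^ k - 1 ∧ (q : Site k) = p := by
  have hN : (0 : ℤ) < 2 ^ k := by positivity
  obtain ⟨z, rfl⟩ := ZMod.intCast_surjective p
  have h1 := Int.emod_nonneg (z - a) hN.ne'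
  have h2 := Int.emod_lt_of_pos (z - a) hN
  refine ⟨a + (z - a) % 2 ^ k, by omega, by omega, ?_⟩
  rw [ZMod.intCast_eq_intCast_iff_dvd_sub]
  refine ⟨(z - a) / 2 ^ k, ?_⟩
  have h3 := Int.emod_add_mul_ediv (z - a) (2 ^ k)
  push_cast
  linarith

theorem intCast_ne_of_lt {k : ℕ} {a b : ℤ} (h1 : a < b) (h2 : b ≤ a + 2 ^ k - 1) :
    (a : Site k) ≠ (b : Site k) := by
  intro h
  rw [ZMod.intCast_eq_intCast_iff_dvd_sub] at h
  have := Int.le_of_dvd (by omega) h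
  push_cast at this
  omega

theorem interval_of_isEmptyInterval {k : ℕ} {i j : ℤ} (h : IsEmptyInterval k i j)
    (h1 : i ≤ j + 1) (h2 : j - i + 1 ≤ 2 ^ k) :
    interval k i j = ∅ ∨ interval k i j = Finset.univ := by
  have hN : (0 : ℤ) < 2 ^ k := by positivity
  obtain ⟨d, hd⟩ := h.dvd
  have hd0 : 0 ≤ d := by nlinarith
  have hd1 : d ≤ 1 := by nlinarith
  obtain rfl | rfl : d = 0 ∨ d = 1 := by omega
  · left
    rw [interval, Finset.Icc_eq_empty (by omega), Finset.image_empty]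
  · right
    refine Finset.eq_univ_of_forall fun s => ?_
    obtain ⟨z, rfl⟩ := ZMod.intCast_surjective s
    rw [intCast_mem_interval]
    have := Int.emod_lt_of_pos (z - i) hN
    omega

theorem length_of_not_isEmptyInterval {k : ℕ} {i j : ℤ} (h : ¬ IsEmptyInterval k i j)
    (h1 : i ≤ j + 1) (h2 : j - i + 1 ≤ 2 ^ k) : i ≤ j ∧ j - i ≤ 2 ^ k - 2 := by
  constructor
  · by_contra h3
    exact h (by rw [show i = j + 1 by omega]; exact Int.ModEq.refl _)
  · by_contra h3
    refine h (Int.modEq_iff_dvd.mpr ⟨1, by omega⟩)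

/-- Translates regions of pairs, which is what the average over `W` produces, back into intervals of
sites. Residues simply double, so no length bound is required. -/
theorem childSite_mem_interval {k : ℕ} {i j : ℤ} (p : Site k) :
    (childSite 1 k p ∈ interval (k + 1) (2 * i + 1) (2 * j + 2) ↔ p ∈ interval k i j) ∧
    (childSite 2 k p ∈ interval (k + 1) (2 * i + 1) (2 * j + 2) ↔ p ∈ interval k i j) := by
  have hN : (0 : ℤ) < 2 ^ k := by positivity
  obtain ⟨q, rfl⟩ := ZMod.intCast_surjective p
  have h1 := Int.emod_nonneg (q - i) hN.ne'
  have h2 := Int.emod_lt_of_pos (q - i) hN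
  have h3 := Int.emod_add_mul_ediv (q - i) (2 ^ k)
  have key : ∀ e : ℤ, 0 ≤ e → e ≤ 1 →
      (2 * q + 1 + e - (2 * i + 1)) % 2 ^ (k + 1) = 2 * ((q - i) % 2 ^ k) + e := by
    intro e he0 he1
    have : 2 * q + 1 + e - (2 * i + 1) =
        2 * ((q - i) % 2 ^ k) + e + 2 ^ (k + 1) * ((q - i) / 2 ^ k) := by
      rw [pow_succ]
      linear_combination 2 * h3.symm
    rw [this, Int.add_mul_emod_self_left, Int.emod_eq_of_lt (by omega) (by rw [pow_succ]; omega)]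
  have k0 := key 0 le_rfl zero_le_one
  have k1 := key 1 zero_le_one le_rfl
  constructor
  · rw [childSite_intCast, intCast_mem_interval, intCast_mem_interval]
    push_cast
    rw [show 2 * q + 1 - (2 * i + 1) = 2 * q + 1 + 0 - (2 * i + 1) by ring, k0]
    omega
  · rw [childSite_intCast, intCast_mem_interval, intCast_mem_interval]
    push_cast
    rw [show 2 * q + 2 - (2 * i + 1) = 2 * q + 1 + 1 - (2 * i + 1) by ring, k1]
    omega

/-! ### Weights of a layer -/

theorem cutWeight_nonneg (c : ℕ) : 0 ≤ cutWeight c := by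
  unfold cutWeight
  positivity

theorem cutWeight_le {c : ℕ} (hc : 1 ≤ c) : cutWeight c ≤ (c : ℝ)⁻¹ := by
  have : (1 : ℝ) ≤ c := by exact_mod_cast hc
  rw [cutWeight, div_le_iff₀ (by positivity), mul_add, sq, inv_mul_cancel_left₀ (by positivity)]
  have : (0 : ℝ) ≤ (c : ℝ)⁻¹ := by positivity
  linarith

theorem layerWeight_nonneg {P S : Type} [Fintype P] [DecidableEq P] [DecidableEq S] (c : ℕ)
    (l r : P → S) (A : Finset S) (B : Finset P) : 0 ≤ layerWeight c l r A B := by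
  have := cutWeight_nonneg c
  refine Finset.prod_nonneg fun p _ => ?_
  unfold inWeight outWeight
  split_ifs <;> positivity

/-- Every cut pair contributes at most `1 / c` whichever side `B` chooses, and every other pair
contributes 0 or 1. -/
theorem layerWeight_le {P S : Type} [Fintype P] [DecidableEq P] [DecidableEq S] {c : ℕ}
    (hc : 1 ≤ c) (l r : P → S) (A : Finset S) (B T : Finset P)
    (hT : ∀ p ∈ T, ¬ (l p ∈ A ↔ r p ∈ A)) : layerWeight c l r A B ≤ (c : ℝ)⁻¹ ^ T.card := by
  have h0 := cutWeight_nonneg c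
  have h1 := cutWeight_le hc
  have h2 : (c : ℝ)⁻¹ ≤ 1 := inv_le_one_of_one_le₀ (by exact_mod_cast hc)
  have h3 : (c : ℝ)⁻¹ ^ T.card = ∏ p, if p ∈ T then (c : ℝ)⁻¹ else 1 := by
    rw [Finset.prod_ite_mem, Finset.univ_inter, Finset.prod_const]
  rw [h3]
  refine Finset.prod_le_prod (fun p _ => ?_) fun p _ => ?_
  · unfold inWeight outWeight
    split_ifs <;> positivity
  · have := hT p
    unfold inWeight outWeight
    split_ifs <;> first | linarith | tauto

theorem layerWeight_eq_zero {P S : Type} [Fintype P] [DecidableEq P] [DecidableEq S] (c : ℕ)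
    (l r : P → S) (A : Finset S) (B : Finset P)
    (h : ¬ ∀ p, (l p ∈ A → r p ∈ A → p ∈ B) ∧ (l p ∉ A → r p ∉ A → p ∉ B)) :
    layerWeight c l r A B = 0 := by
  push Not at h
  obtain ⟨p, hp⟩ := h
  refine Finset.prod_eq_zero (Finset.mem_univ p) ?_
  unfold inWeight outWeight
  split_ifs <;> first | rfl | tauto

/-- The regions that contribute to the average purity of an interval are the intervals that are
reached by a reduction step. -/
theorem exists_reduction {k : ℕ} {i j : ℤ} (h : ¬ IsEmptyInterval (k + 1) i j) (h1 : i ≤ j + 1)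
    (h2 : j - i + 1 ≤ 2 ^ (k + 1)) {c : ℕ} (hc : 1 ≤ c) (t : ℕ) (B : Finset (Site k))
    (hB : layerWeight c (childSite t k) (childSite (t + 1) k) (interval (k + 1) i j) B ≠ 0) :
    ∃ m n : ℤ, (m - t) % 2 = 0 ∧ (n - t) % 2 = 1 ∧ |m - i| ≤ 1 ∧ |n - j| ≤ 1 ∧ m ≤ n + 1 ∧
      n - m + 1 ≤ 2 ^ (k + 1) ∧ B = interval k ((m - t) / 2) ((n - t - 1) / 2) ∧
      layerWeight c (childSite t k) (childSite (t + 1) k) (interval (k + 1) i j) B ≤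
        Real.exp (-(Real.log c * ((|m - i| + |n - j| : ℤ) : ℝ))) := by
  obtain ⟨hij, hlen⟩ := length_of_not_isEmptyInterval h h1 h2
  have hN : (0 : ℤ) < 2 ^ k := by positivity
  have hN2 : (2 : ℤ) ^ (k + 1) = 2 * 2 ^ k := by rw [pow_succ]; ring
  -- A non-zero weight fixes `B` on all uncut pairs, so `B` is free only on the pairs cut at `i` or
  -- `j`.
  have hcons := not_imp_comm.mp (layerWeight_eq_zero c _ _ _ B) hB
  -- The pair `q` consists of the sites `2q + t, 2q + t + 1`; thus `a` and `b` are the pairs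
  -- containing `i` and `j`.
  set a := (i - t) / 2 with ha
  set b := (j - t) / 2 with hb
  have hmem : ∀ q : ℤ, a ≤ q → q ≤ a + 2 ^ k - 1 →
      (childSite t k (q : Site k) ∈ interval (k + 1) i j ↔ i ≤ 2 * q + t ∧ 2 * q + t ≤ j) ∧
      (childSite (t + 1) k (q : Site k) ∈ interval (k + 1) i j ↔
        i ≤ 2 * q + t + 1 ∧ 2 * q + t + 1 ≤ j) := by
    intro q hq1 hq2
    rw [childSite_intCast, childSite_intCast,
      show 2 * q + ((t + 1 : ℕ) : ℤ) = 2 * q + t + 1 by push_cast; ring]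
    exact ⟨intCast_mem_interval_of_le (k := k + 1) (i := i) (j := j) (z := 2 * q + t)
      (by omega) (by omega), intCast_mem_interval_of_le (k := k + 1) (i := i) (j := j)
      (z := 2 * q + t + 1) (by omega) (by omega)⟩
  have hin : ∀ q : ℤ, a ≤ q → q ≤ a + 2 ^ k - 1 → i ≤ 2 * q + t → 2 * q + t + 1 ≤ j →
      (q : Site k) ∈ B := by
    intro q hq1 hq2 h3 h4
    exact (hcons q).1 ((hmem q hq1 hq2).1.mpr (by omega)) ((hmem q hq1 hq2).2.mpr (by omega))
  have hout : ∀ q : ℤ, a ≤ q → q ≤ a + 2 ^ k - 1 → (2 * q + t + 1 < i ∨ j < 2 * q + t) →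
      (q : Site k) ∉ B := by
    intro q hq1 hq2 h3
    exact (hcons q).2 (fun h => by have := (hmem q hq1 hq2).1.mp h; omega)
      (fun h => by have := (hmem q hq1 hq2).2.mp h; omega)
  -- The endpoint moves only if pair `a` is cut: outwards if `a` lies in `B`, inwards otherwise. The
  -- same is done for `n` with `b`.
  obtain ⟨m, hm2, hmi, hml, hmr⟩ : ∃ m : ℤ, (m - t) % 2 = 0 ∧ |m - i| = (i - t) % 2 ∧
      ((i - t) % 2 = 1 → (a : Site k) ∈ B → m = i - 1) ∧
      ((i - t) % 2 = 1 → (a : Site k) ∉ B → m = i + 1) := by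
    by_cases hi : (i - t) % 2 = 0
    · exact ⟨i, by omega, by simp [hi], by omega, by omega⟩
    · by_cases hB : (a : Site k) ∈ B
      · refine ⟨i - 1, by omega, ?_, by simp, by tauto⟩
        rw [abs_eq_max_neg]
        omega
      · refine ⟨i + 1, by omega, ?_, by tauto, by simp⟩
        rw [abs_eq_max_neg]
        omega
  obtain ⟨n, hn2, hnj, hnl, hnr⟩ : ∃ n : ℤ, (n - t) % 2 = 1 ∧ |n - j| = 1 - (j - t) % 2 ∧
      ((j - t) % 2 = 0 → (b : Site k) ∈ B → n = j + 1) ∧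
      ((j - t) % 2 = 0 → (b : Site k) ∉ B → n = j - 1) := by
    by_cases hj : (j - t) % 2 = 1
    · exact ⟨j, by omega, by simp [hj], by omega, by omega⟩
    · by_cases hB : (b : Site k) ∈ B
      · refine ⟨j + 1, by omega, ?_, by simp, by tauto⟩
        rw [abs_eq_max_neg]
        omega
      · refine ⟨j - 1, by omega, ?_, by tauto, by simp⟩
        rw [abs_eq_max_neg]
        omega
  have hmi' := hmi
  have hnj' := hnj
  rw [abs_eq_max_neg] at hmi' hnj'
  refine ⟨m, n, hm2, hn2, by omega, by omega, by omega, by omega, ?_, ?_⟩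
  · ext p
    obtain ⟨q, hq1, hq2, rfl⟩ := exists_intCast_eq a p
    rw [intCast_mem_interval_of_le (by omega) (by omega)]
    have hin' := hin q hq1 hq2
    have hout' := hout q hq1 hq2
    by_cases hx : (q : Site k) ∈ B
    · have h3 : ¬ (2 * q + t + 1 < i ∨ j < 2 * q + t) := fun h => hout' h hx
      have h4 : q = a → (i - t) % 2 = 1 → m = i - 1 := fun h => by subst h; exact fun h => hml h hx
      have h5 : q = b → (j - t) % 2 = 0 → n = j + 1 := fun h => by subst h; exact fun h => hnl h hx
      simp only [hx, true_iff]
      omega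
    · have h3 : ¬ (i ≤ 2 * q + t ∧ 2 * q + t + 1 ≤ j) := fun h => hx (hin' h.1 h.2)
      have h4 : q = a → (i - t) % 2 = 1 → m = i + 1 := fun h => by subst h; exact fun h => hmr h hx
      have h5 : q = b → (j - t) % 2 = 0 → n = j - 1 := fun h => by subst h; exact fun h => hnr h hx
      simp only [hx, false_iff]
      omega
  -- `T` is the set of cut pairs. When both ends are cut, the two pairs differ because the interval
  -- is neither empty nor the full ring, so the number of cut pairs equals the total shift.
  · set T : Finset (Site k) := (if (i - t) % 2 = 1 then {(a : Site k)} else ∅) ∪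
      (if (j - t) % 2 = 0 then {(b : Site k)} else ∅) with hT
    have hcard : (T.card : ℤ) = |m - i| + |n - j| := by
      rw [hmi, hnj, hT]
      by_cases hi : (i - t) % 2 = 1 <;> by_cases hj : (j - t) % 2 = 0
      · rw [if_pos hi, if_pos hj, Finset.card_union_of_disjoint (Finset.disjoint_singleton.mpr
          (intCast_ne_of_lt (by omega) (by omega)))]
        simp [hi, hj]
      · rw [if_pos hi, if_neg hj]
        simp
        omega
      · rw [if_neg hi, if_pos hj]
        simp
        omega
      · rw [if_neg hi, if_neg hj]
        simp
        omega
    have hcut : ∀ p ∈ T, ¬ (childSite t k p ∈ interval (k + 1) i j ↔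
        childSite (t + 1) k p ∈ interval (k + 1) i j) := by
      intro p hp
      rw [hT, Finset.mem_union] at hp
      rcases hp with hp | hp
      · split_ifs at hp with hi
        · rw [Finset.mem_singleton] at hp
          subst hp
          rw [(hmem a (by omega) (by omega)).1, (hmem a (by omega) (by omega)).2]
          omega
        · simp at hp
      · split_ifs at hp with hj
        · rw [Finset.mem_singleton] at hp
          subst hp
          rw [(hmem b (by omega) (by omega)).1, (hmem b (by omega) (by omega)).2]
          omega
        · simp at hp
    refine (layerWeight_le hc _ _ _ B T hcut).trans (le_of_eq ?_)
    have hc0 : (0 : ℝ) < c := by exact_mod_cast hc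
    rw [← hcard, Int.cast_natCast, ← Real.exp_log (inv_pos.mpr hc0), ← Real.exp_nat_mul,
      Real.log_inv]
    congr 1
    ring

/-- One reduction step: a bound for all the intervals reached by it bounds the weighted sum. -/
theorem sum_layerWeight_mul_le {k : ℕ} {i j : ℤ} (h : ¬ IsEmptyInterval (k + 1) i j)
    (h1 : i ≤ j + 1) (h2 : j - i + 1 ≤ 2 ^ (k + 1)) {c : ℕ} (hc : 1 ≤ c) (t : ℕ)
    (f : Finset (Site k) → ℝ) (μ : ℝ)
    (hf : ∀ m n : ℤ, (m - t) % 2 = 0 → (n - t) % 2 = 1 → |m - i| ≤ 1 → |n - j| ≤ 1 → m ≤ n + 1 →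
      n - m + 1 ≤ 2 ^ (k + 1) → f (interval k ((m - t) / 2) ((n - t - 1) / 2)) ≤
        Real.exp (-(μ - Real.log c * ((|m - i| + |n - j| : ℤ) : ℝ) + Real.log 9))) :
    ∑ B, layerWeight c (childSite t k) (childSite (t + 1) k) (interval (k + 1) i j) B * f B ≤
      Real.exp (-μ) := by
  set w := layerWeight c (childSite t k) (childSite (t + 1) k) (interval (k + 1) i j) with hw
  set F : ℤ × ℤ → Finset (Site k) := fun s =>
    interval k ((i + s.1 - t) / 2) ((j + s.2 - t - 1) / 2) with hF
  -- Three shifts at each endpoint give the bound 9; counting parities would lower it, but only a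
  -- universal constant is needed.
  set 𝓑 : Finset (Finset (Site k)) :=
    ((Finset.Icc (-1) 1 ×ˢ Finset.Icc (-1) 1).image F).filter fun B => w B ≠ 0 with h𝓑
  have hcard : (𝓑.card : ℝ) ≤ 9 := by
    have : 𝓑.card ≤ 9 := ((Finset.card_filter_le _ _).trans Finset.card_image_le).trans (by simp)
    exact_mod_cast this
  have hterm : ∀ B, w B ≠ 0 → B ∈ 𝓑 ∧ w B * f B ≤ Real.exp (-μ) / 9 := by
    intro B hB
    obtain ⟨m, n, hm, hn, hmi, hnj, hmn, hlen, rfl, hle⟩ := exists_reduction h h1 h2 hc t B hB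
    refine ⟨?_, ?_⟩
    · rw [h𝓑, Finset.mem_filter, Finset.mem_image]
      refine ⟨⟨(m - i, n - j), ?_, ?_⟩, hB⟩
      · rw [abs_le] at hmi hnj
        simp only [Finset.mem_product, Finset.mem_Icc]
        omega
      · simp [hF]
    · have h3 := hf m n hm hn hmi hnj hmn hlen
      calc _ ≤ w _ * Real.exp (-(μ - Real.log c * ((|m - i| + |n - j| : ℤ) : ℝ) + Real.log 9)) :=
            mul_le_mul_of_nonneg_left h3 (layerWeight_nonneg _ _ _ _ _)
        _ ≤ Real.exp (-(Real.log c * ((|m - i| + |n - j| : ℤ) : ℝ))) *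
            Real.exp (-(μ - Real.log c * ((|m - i| + |n - j| : ℤ) : ℝ) + Real.log 9)) :=
            mul_le_mul_of_nonneg_right hle (Real.exp_nonneg _)
        _ = Real.exp (-μ) / 9 := by
            rw [← Real.exp_add, ← Real.exp_log (show (0 : ℝ) < 9 by norm_num), ← Real.exp_sub,
              Real.exp_log (by norm_num)]
            congr 1
            ring
  calc ∑ B, w B * f B = ∑ B ∈ 𝓑, w B * f B := by
        refine (Finset.sum_subset (Finset.subset_univ _) fun B _ hB => ?_).symm
        by_cases h0 : w B = 0
        · rw [h0, zero_mul]
        · exact (hB (hterm B h0).1).elim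
    _ ≤ 𝓑.card • (Real.exp (-μ) / 9) := Finset.sum_le_card_nsmul _ _ _ fun B hB =>
        (hterm B (Finset.mem_filter.mp hB).2).2
    _ ≤ Real.exp (-μ) := by
        rw [nsmul_eq_mul]
        nlinarith [Real.exp_nonneg (-μ)]

/-! ### Reduction sequences -/

/-- The congruence is modulo 1. On the single-site ring only `RedSeq.nil` is possible, which ends
every recursion over levels. -/
theorem isEmptyInterval_zero (i j : ℤ) : IsEmptyInterval 0 i j := by
  rw [IsEmptyInterval, pow_zero]
  exact Int.modEq_one

theorem exists_redSeq_sigma {k : ℕ} (h : ∀ i j, Nonempty (RedSeq .tau k i j)) (i j : ℤ) :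
    Nonempty (RedSeq .sigma k i j) := by
  by_cases he : IsEmptyInterval k i j
  · exact ⟨.nil he⟩
  · obtain ⟨Q⟩ := h (2 * (i / 2) + 1) (2 * (j / 2))
    exact ⟨.stepW _ _ he (by omega) (by omega) (by rw [abs_le]; omega) (by rw [abs_le]; omega) Q⟩

theorem exists_redSeq_tau : ∀ (k : ℕ) (i j : ℤ), Nonempty (RedSeq .tau k i j)
  | 0, i, j => ⟨.nil (isEmptyInterval_zero i j)⟩
  | k + 1, i, j => by
    by_cases he : IsEmptyInterval (k + 1) i j
    · exact ⟨.nil he⟩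
    · obtain ⟨Q⟩ := exists_redSeq_sigma (exists_redSeq_tau k) (2 * (i / 2) / 2)
        ((2 * (j / 2) + 1 - 1) / 2)
      exact ⟨.stepV _ _ he (by omega) (by omega) (by rw [abs_le]; omega) (by rw [abs_le]; omega) Q⟩

section Values

variable (D D' : ℕ → ℕ) (C : ℝ)

/-- A step has finitely many choices of `m, n`, and shifts the values of the remaining sequence by a
constant. Finiteness of the set of values suffices for attainment, with no enumeration of the
sequences themselves. -/
theorem finite_values_sigma {k : ℕ} (h : ∀ i j, (Set.range fun Q : RedSeq .tau k i j =>
    Q.S D D' - C * (Q.height : ℝ)).Finite) (i j : ℤ) :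
    (Set.range fun Q : RedSeq .sigma k i j => Q.S D D' - C * (Q.height : ℝ)).Finite := by
  refine Set.Finite.subset (s := {0} ∪ ⋃ m ∈ Set.Icc (i - 1) (i + 1), ⋃ n ∈ Set.Icc (j - 1) (j + 1),
    (fun v => Real.log (D k) * ((|m - i| + |n - j| : ℤ) : ℝ) + v - C) ''
      Set.range fun Q : RedSeq .tau k m n => Q.S D D' - C * (Q.height : ℝ)) ?_ ?_
  · exact (Set.finite_singleton 0).union ((Set.finite_Icc _ _).biUnion fun m _ =>
      (Set.finite_Icc _ _).biUnion fun n _ => (h m n).image _)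
  · rintro _ ⟨Q, rfl⟩
    cases Q with
    | nil _ => simp [RedSeq.S, RedSeq.height]
    | stepW m n _ _ _ hmi hnj Q =>
      rw [abs_le] at hmi hnj
      refine Or.inr (Set.mem_biUnion (x := m) ⟨by omega, by omega⟩
        (Set.mem_biUnion (x := n) ⟨by omega, by omega⟩ ⟨_, ⟨Q, rfl⟩, ?_⟩))
      simp only [RedSeq.S, RedSeq.height]
      push_cast
      ring

theorem finite_values_tau : ∀ (k : ℕ) (i j : ℤ),
    (Set.range fun Q : RedSeq .tau k i j => Q.S D D' - C * (Q.height : ℝ)).Finite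
  | 0, i, j => by
    refine (Set.finite_singleton 0).subset ?_
    rintro _ ⟨Q, rfl⟩
    cases Q with
    | nil _ => simp [RedSeq.S, RedSeq.height]
  | k + 1, i, j => by
    refine Set.Finite.subset (s := {0} ∪ ⋃ m ∈ Set.Icc (i - 1) (i + 1),
      ⋃ n ∈ Set.Icc (j - 1) (j + 1),
      (fun v => Real.log (D' (k + 1)) * ((|m - i| + |n - j| : ℤ) : ℝ) + v - C) ''
        Set.range fun Q : RedSeq .sigma k (m / 2) ((n - 1) / 2) =>
          Q.S D D' - C * (Q.height : ℝ)) ?_ ?_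
    · exact (Set.finite_singleton 0).union ((Set.finite_Icc _ _).biUnion fun m _ =>
        (Set.finite_Icc _ _).biUnion fun n _ =>
        (finite_values_sigma D D' C (finite_values_tau k) _ _).image _)
    · rintro _ ⟨Q, rfl⟩
      cases Q with
      | nil _ => simp [RedSeq.S, RedSeq.height]
      | stepV m n _ _ _ hmi hnj Q =>
        rw [abs_le] at hmi hnj
        refine Or.inr (Set.mem_biUnion (x := m) ⟨by omega, by omega⟩
          (Set.mem_biUnion (x := n) ⟨by omega, by omega⟩ ⟨_, ⟨Q, rfl⟩, ?_⟩))
        simp only [RedSeq.S, RedSeq.height]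
        push_cast
        ring

end Values

theorem exists_isLeast_range {ι : Type} [Nonempty ι] {f : ι → ℝ} (h : (Set.range f).Finite) :
    ∃ μ, IsLeast (Set.range f) μ := by
  obtain ⟨μ, hμ, hle⟩ := Set.exists_min_image _ id h (Set.range_nonempty f)
  exact ⟨μ, hμ, hle⟩

/-! ### Bounds on the average purity and the average entropy -/

section Bounds

variable {L : ℕ} {D D' : ℕ → ℕ}

/-- Positivity propagates from `D 0 = 1`: a zero `D' (k + 1)` would force `D k = 0`. -/
theorem Admissible.one_le (h : Admissible L D D') (hD : D 0 = 1) : ∀ k ≤ L, 1 ≤ D k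
  | 0, _ => hD.ge
  | k + 1, hk => by
    have h1 := h.one_le hD k (by omega)
    obtain ⟨h2, h3⟩ := h k hk
    have : D' (k + 1) ≠ 0 := by
      intro h0
      rw [h0] at h2
      simp at h2
      omega
    omega

theorem Admissible.one_le' (h : Admissible L D D') (hD : D 0 = 1) (k : ℕ) (hk : k < L) :
    1 ≤ D' (k + 1) := by
  have h1 := h.one_le hD k hk.le
  have h2 := (h k hk).1
  by_contra h0
  rw [show D' (k + 1) = 0 by omega] at h2
  simp at h2
  omega

theorem purity_of_isEmptyInterval {k d : ℕ} (ψ : State (Site k) d) (hψ : purity ψ ∅ = 1) {i j : ℤ}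
    (h : IsEmptyInterval k i j) (h1 : i ≤ j + 1) (h2 : j - i + 1 ≤ 2 ^ k) :
    purity ψ (interval k i j) = 1 := by
  rcases interval_of_isEmptyInterval h h1 h2 with h | h
  · rw [h, hψ]
  · rw [h, purity_univ, hψ]

/-- Quantifying over all lower bounds `μ` instead of the minimum keeps attainment out of the
induction. The half-step through `V` is separate because it serves both the recursion for `σ` and
the final bound for `τ`. -/
theorem Admissible.integral_purity_phi_le (h : Admissible L D D') (hD : D 0 = 1) {k : ℕ}
    (hk : k < L)
    (ih : ∀ i j : ℤ, i ≤ j + 1 → j - i + 1 ≤ 2 ^ k → ∀ μ : ℝ,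
      (∀ Q : RedSeq .sigma k i j, μ ≤ Q.S D D' - Real.log 9 * (Q.height : ℝ)) →
      ∫ g, (purity (psi g k hk.le) (interval k i j)).re ∂meraLaw L D D' ≤ Real.exp (-μ))
    {i j : ℤ} (h1 : i ≤ j + 1) (h2 : j - i + 1 ≤ 2 ^ (k + 1)) {μ : ℝ}
    (hμ : ∀ Q : RedSeq .tau (k + 1) i j, μ ≤ Q.S D D' - Real.log 9 * (Q.height : ℝ)) :
    ∫ g, (purity (phi g k hk) (interval (k + 1) i j)).re ∂meraLaw L D D' ≤ Real.exp (-μ) := by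
  have := h.isProbabilityMeasure_meraLaw
  by_cases he : IsEmptyInterval (k + 1) i j
  · simp only [fun g : Gates L D D' => purity_of_isEmptyInterval (phi g k hk)
      (purity_phi_empty hD g k hk) he h1 h2]
    have := hμ (.nil he)
    simp [RedSeq.S, RedSeq.height] at this ⊢
    exact this
  · rw [h.integral_purity_phi]
    refine sum_layerWeight_mul_le he h1 h2 (h.one_le' hD k hk) 0 (fun B =>
      ∫ g, (purity (psi g k hk.le) B).re ∂meraLaw L D D') μ ?_
    intro m n hm hn hmi hnj hmn hlen
    rw [pow_succ] at hlen
    simp only [Nat.cast_zero, sub_zero] at hm hn ⊢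
    -- Prefixing `Q` with the present step adds its cost to `S` and 1 to the height, so `μ - cost +
    -- log 9` is a lower bound for `Q`.
    refine ih _ _ (by omega) (by omega) _ fun Q => ?_
    have h3 := hμ (.stepV m n he hm hn hmi hnj Q)
    simp only [RedSeq.S, RedSeq.height] at h3
    push_cast at h3 ⊢
    linarith

theorem Admissible.integral_purity_psi_le (h : Admissible L D D') (hD : D 0 = 1) :
    ∀ (k : ℕ) (hk : k ≤ L) (i j : ℤ), i ≤ j + 1 → j - i + 1 ≤ 2 ^ k → ∀ μ : ℝ,
      (∀ Q : RedSeq .sigma k i j, μ ≤ Q.S D D' - Real.log 9 * (Q.height : ℝ)) →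
      ∫ g, (purity (psi g k hk) (interval k i j)).re ∂meraLaw L D D' ≤ Real.exp (-μ) := by
  have := h.isProbabilityMeasure_meraLaw
  have empty : ∀ (k : ℕ) (hk : k ≤ L) (i j : ℤ), i ≤ j + 1 → j - i + 1 ≤ 2 ^ k → ∀ μ : ℝ,
      (∀ Q : RedSeq .sigma k i j, μ ≤ Q.S D D' - Real.log 9 * (Q.height : ℝ)) →
      IsEmptyInterval k i j →
      ∫ g, (purity (psi g k hk) (interval k i j)).re ∂meraLaw L D D' ≤ Real.exp (-μ) := by
    intro k hk i j h1 h2 μ hμ he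
    simp only [fun g : Gates L D D' => purity_of_isEmptyInterval (psi g k hk)
      (purity_psi_empty hD g k hk) he h1 h2]
    have := hμ (.nil he)
    simp [RedSeq.S, RedSeq.height] at this ⊢
    exact this
  intro k
  induction k with
  | zero =>
    intro hk i j h1 h2 μ hμ
    exact empty 0 hk i j h1 h2 μ hμ (isEmptyInterval_zero i j)
  | succ k ih =>
    intro hk i j h1 h2 μ hμ
    by_cases he : IsEmptyInterval (k + 1) i j
    · exact empty (k + 1) hk i j h1 h2 μ hμ he
    rw [h.integral_purity_psi]
    refine sum_layerWeight_mul_le he h1 h2 (h.one_le hD (k + 1) hk) 1 (fun B =>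
      ∫ g, (purity (pairState (phi g k hk)) B).re ∂meraLaw L D D') μ ?_
    intro m n hm hn hmi hnj hmn hlen
    have hmem : ∀ p, (childSite 1 k p ∈ interval (k + 1) m n ↔
          p ∈ interval k ((m - (1 : ℕ)) / 2) ((n - (1 : ℕ) - 1) / 2)) ∧
        (childSite 2 k p ∈ interval (k + 1) m n ↔
          p ∈ interval k ((m - (1 : ℕ)) / 2) ((n - (1 : ℕ) - 1) / 2)) := by
      intro p
      have := childSite_mem_interval (i := (m - (1 : ℕ)) / 2) (j := (n - (1 : ℕ) - 1) / 2) p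
      rwa [show 2 * ((m - (1 : ℕ)) / 2) + 1 = m by omega,
        show 2 * ((n - (1 : ℕ) - 1) / 2) + 2 = n by omega] at this
    simp only [purity_pairState _ (fun p => (hmem p).1) (fun p => (hmem p).2)]
    refine h.integral_purity_phi_le hD hk (ih (by omega)) hmn hlen fun Q => ?_
    have h3 := hμ (.stepW m n he (by omega) (by omega) hmi hnj Q)
    simp only [RedSeq.S, RedSeq.height] at h3
    push_cast at h3 ⊢
    linarith

/-- Jensen's inequality in the form of a tangent to the logarithm. -/
theorem le_integral_neg_log {X : Type} [MeasurableSpace X] {P : Measure X} [IsProbabilityMeasure P]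
    {f : X → ℝ} (hpos : ∀ x, 0 < f x) (hf : Integrable f P)
    (hlog : Integrable (fun x => -Real.log (f x)) P) {μ : ℝ} (h : ∫ x, f x ∂P ≤ Real.exp (-μ)) :
    μ ≤ ∫ x, -Real.log (f x) ∂P := by
  -- The integrand on the left is the tangent to `-log` at `exp (-μ)`; its integral is at least `μ`
  -- by the hypothesis on the mean.
  have h1 : ∫ x, (μ + 1 - Real.exp μ * f x) ∂P ≤ ∫ x, -Real.log (f x) ∂P := by
    refine integral_mono ((integrable_const _).sub (hf.const_mul _)) hlog fun x => ?_
    have h2 := Real.log_le_sub_one_of_pos (mul_pos (Real.exp_pos μ) (hpos x))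
    rw [Real.log_mul (Real.exp_pos μ).ne' (hpos x).ne', Real.log_exp] at h2
    simp only
    linarith
  rw [integral_sub (integrable_const _) (hf.const_mul _), integral_const, integral_const_mul,
    probReal_univ, one_smul] at h1
  have h3 : Real.exp μ * ∫ x, f x ∂P ≤ 1 := by
    calc _ ≤ Real.exp μ * Real.exp (-μ) := mul_le_mul_of_nonneg_left h (Real.exp_nonneg _)
      _ = 1 := by rw [← Real.exp_add, add_neg_cancel, Real.exp_zero]
  linarith

end Bounds

end

end RandomMERA

/-! ### From average purity to average entropy -/

theorem lemma1 :
    ∃ C : ℝ, 0 < C ∧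
      ∀ (L : ℕ) (D D' : ℕ → ℕ), D 0 = 1 →
        (∀ k < L, D k ≤ D' (k + 1) ^ 2 ∧ D' (k + 1) ≤ D (k + 1)) →
        (∀ (k : ℕ) (hk : k ≤ L) (i j : ℤ), i ≤ j + 1 → j - i + 1 ≤ 2 ^ k →
          Integrable (RandomMERA.entropySigma k hk i j) (RandomMERA.meraLaw L D D') ∧
          ∃ μ : ℝ,
            IsLeast (Set.range fun Q : RandomMERA.RedSeq .sigma k i j =>
              Q.S D D' - C * (Q.height : ℝ)) μ ∧
            μ ≤ ∫ g, RandomMERA.entropySigma k hk i j g ∂(RandomMERA.meraLaw L D D')) ∧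
        (∀ (k : ℕ) (hk : k < L) (i j : ℤ), i ≤ j + 1 → j - i + 1 ≤ 2 ^ (k + 1) →
          Integrable (RandomMERA.entropyTau k hk i j) (RandomMERA.meraLaw L D D') ∧
          ∃ μ : ℝ,
            IsLeast (Set.range fun Q : RandomMERA.RedSeq .tau (k + 1) i j =>
              Q.S D D' - C * (Q.height : ℝ)) μ ∧
            μ ≤ ∫ g, RandomMERA.entropyTau k hk i j g ∂(RandomMERA.meraLaw L D D')) := by
  -- The constant is the logarithm of the bound 9 on the number of choices per reduction step.
  refine ⟨Real.log 9, Real.log_pos (by norm_num), fun L D D' hD hdim => ?_⟩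
  have h : RandomMERA.Admissible L D D' := hdim
  have := h.isProbabilityMeasure_meraLaw
  refine ⟨fun k hk i j h1 h2 => ?_, fun k hk i j h1 h2 => ?_⟩
  · have hE : RandomMERA.entropySigma (L := L) (D := D) (D' := D') k hk i j = fun g =>
        -Real.log (RandomMERA.purity (RandomMERA.psi g k hk) (RandomMERA.interval k i j)).re :=
      funext fun g => RandomMERA.renyiTwo_reducedDensity _ _
    have hpos : ∀ g : RandomMERA.Gates L D D',
        0 < (RandomMERA.purity (RandomMERA.psi g k hk) (RandomMERA.interval k i j)).re := fun g =>
      RandomMERA.purity_re_pos _ _ (by rw [RandomMERA.purity_psi_empty hD]; exact one_ne_zero)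
    have hc := RandomMERA.continuous_purity (RandomMERA.continuous_psi (L := L) (D := D) (D' := D')
      k hk) (RandomMERA.interval k i j)
    have hi : Integrable (fun g : RandomMERA.Gates L D D' =>
        -Real.log (RandomMERA.purity (RandomMERA.psi g k hk) (RandomMERA.interval k i j)).re)
        (RandomMERA.meraLaw L D D') :=
      RandomMERA.integrable_of_continuous (hc.log fun g => (hpos g).ne').neg
    rw [hE]
    have := RandomMERA.exists_redSeq_sigma (RandomMERA.exists_redSeq_tau k) i j
    obtain ⟨μ, hμ⟩ := RandomMERA.exists_isLeast_range (RandomMERA.finite_values_sigma D D'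
      (Real.log 9) (RandomMERA.finite_values_tau D D' (Real.log 9) k) i j)
    exact ⟨hi, μ, hμ, RandomMERA.le_integral_neg_log hpos (RandomMERA.integrable_of_continuous hc)
      hi (h.integral_purity_psi_le hD k hk i j h1 h2 μ fun Q => hμ.2 ⟨Q, rfl⟩)⟩
  · have hE : RandomMERA.entropyTau (L := L) (D := D) (D' := D') k hk i j = fun g =>
        -Real.log (RandomMERA.purity (RandomMERA.phi g k hk)
          (RandomMERA.interval (k + 1) i j)).re :=
      funext fun g => RandomMERA.renyiTwo_reducedDensity _ _
    have hpos : ∀ g : RandomMERA.Gates L D D',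
        0 < (RandomMERA.purity (RandomMERA.phi g k hk)
          (RandomMERA.interval (k + 1) i j)).re := fun g =>
      RandomMERA.purity_re_pos _ _ (by rw [RandomMERA.purity_phi_empty hD]; exact one_ne_zero)
    have hc := RandomMERA.continuous_purity (RandomMERA.continuous_phi (L := L) (D := D) (D' := D')
      k hk) (RandomMERA.interval (k + 1) i j)
    have hi : Integrable (fun g : RandomMERA.Gates L D D' =>
        -Real.log (RandomMERA.purity (RandomMERA.phi g k hk)
          (RandomMERA.interval (k + 1) i j)).re) (RandomMERA.meraLaw L D D') :=
      RandomMERA.integrable_of_continuous (hc.log fun g => (hpos g).ne').neg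
    rw [hE]
    have := RandomMERA.exists_redSeq_tau (k + 1) i j
    obtain ⟨μ, hμ⟩ := RandomMERA.exists_isLeast_range
      (RandomMERA.finite_values_tau D D' (Real.log 9) (k + 1) i j)
    exact ⟨hi, μ, hμ, RandomMERA.le_integral_neg_log hpos (RandomMERA.integrable_of_continuous hc)
      hi (h.integral_purity_phi_le hD hk (h.integral_purity_psi_le hD k hk.le) h1 h2
        fun Q => hμ.2 ⟨Q, rfl⟩)⟩
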